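/- **Model.** There are finitely many customer types $i\in\mathcal I$ and server types $s\in\mathcal S$. A server of type $s$ can be in any configuration $\boldsymbol k=(k_i)_{i\in\mathcal I}$ from a finite set $\bar{\mathcal K}^s\subset\mathbb Z_+^{\mathcal I}$ that contains $\boldsymbol 0$ and is closed downwards (if $\boldsymbol k\in\bar{\mathcal K}^s$ and $\boldsymbol k'\le\boldsymbol k$ componentwise, then $\boldsymbol k'\in\bar{\mathcal K}^s$); for every $i$ there is an $s$ with $\boldsymbol e_i\in\bar{\mathcal K}^s$. Let $\bar{\mathcal K}$ be the disjoint union of the $\bar{\mathcal K}^s$ and $\mathcal K$ the set of its nonzero configurations, $\mathcal K^s$ those of type $s$; $\boldsymbol k\pm\boldsymbol e_i$ denotes the configuration of the same server type with $k_i\pm1$ in place of $k_i$. Fix $\lambda_i,\mu_i>0$ and $h_s>0$, and put $\rho_i=\lambda_i/\mu_i$. In the system with scaling parameter $r$, type-$i$ customers arrive as independent Poisson processes of rates $\lambda_i r$, service times are independent exponential with mean $1/\mu_i$, and there are $H^r_s$ servers of type $s$, where $H^r_s=h_sr$ (or, more generally, $H^r_s\in\mathbb Z_+$ with $H^r_s/r\to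 h_s$). Under GRAND-F, an arriving customer of type $i$ is placed into a server chosen uniformly at random among all servers whose configuration $\boldsymbol k$ satisfies $\boldsymbol k+\boldsymbol e_i\in\bar{\mathcal K}$, and is blocked if there is none. $X^r_{\boldsymbol k}(t)$ is the number of servers in configuration $\boldsymbol k$ at time $t$. **Fluid sample paths.** Edges are the pairs $(\boldsymbol k,i)$ with $\boldsymbol k,\ \boldsymbol k-\boldsymbol e_i\in\bar{\mathcal K}$. Let $D^r_{\boldsymbol ki}(t)$ and $A^r_{\boldsymbol ki}(t)$ be the numbers, in $[0,t]$, of departures taking a server from $\boldsymbol k$ to $\boldsymbol k-\boldsymbol e_i$ and of arrivals taking a server from $\boldsymbol k-\boldsymbol e_i$ to $\boldsymbol k$. The systems for all $r$ are driven by common primitives: unit-rate Poisson processes $\Pi_{\boldsymbol ki}$ and $\Pi_i$, and i.i.d. uniform variables $\xi_i(1),\xi_i(2),\dots$ in $[0,1]$. Here $D^r_{\boldsymbol ki}(t)=\Pi_{\boldsymbol ki}\big(\int_0^tk_i\mu_iX^r_{\boldsymbol k}(u)\,du\big)$, the type-$i$ arrivals in $[0,t]$ number $\Pi_i(\lambda_irt)$,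 and the $m$-th of them is placed according to the state just before its arrival: with $X^r_{(i)}=\sum_{\boldsymbol k:\,\boldsymbol k+\boldsymbol e_i\in\bar{\mathcal K}}X^r_{\boldsymbol k}>0$, the interval $(0,1]$ is divided, in a fixed order of these $\boldsymbol k$, into consecutive intervals $(\cdot,\cdot]$ of lengths $X^r_{\boldsymbol k}/X^r_{(i)}$, and the customer joins a server in the configuration whose interval contains $\xi_i(m)$. A *fluid sample path* (FSP) is a triple of locally Lipschitz functions $(x_{\boldsymbol k}(\cdot))_{\boldsymbol k\in\mathcal K}$, $(d_{\boldsymbol ki}(\cdot))$, $(a_{\boldsymbol ki}(\cdot))$ on $[0,\infty)$ for which there are a realization of the primitives and a subsequence of $r\to\infty$ such that, as $r\to\infty$, for all $(\boldsymbol k,i)$, $$\tfrac1r\Pi_{\boldsymbol ki}(rt)\to t,\qquad \tfrac1r\Pi_i(rt)\to t,\qquad \tfrac1r\#\{m\le\lfloor ru\rfloor:\ \xi_i(m)\le\zeta\}\to u\zeta,$$ uniformly on compact subsets of $t\ge0$, respectively of $(u,\zeta)\in[0,\infty)\times[0,1]$, and, along the subsequence, $\tfrac1r(X^r,D^r,A^r)\to(x,d,a)$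 uniformly on compact sets (with some initial states $X^r(0)$). **Equilibrium.** Let $$\mathcal X^\Box=\Big\{\boldsymbol x\in\mathbb R_+^{\mathcal K}:\ \sum_{\boldsymbol k\in\mathcal K^s}x_{\boldsymbol k}\le h_s\ \ \forall s\Big\},\qquad x_{\boldsymbol 0^s}:=h_s-\sum_{\boldsymbol k\in\mathcal K^s}x_{\boldsymbol k},$$ $$\mathcal X^\diamond=\Big\{\boldsymbol x\in\mathcal X^\Box:\ \sum_{\boldsymbol k\in\mathcal K}k_ix_{\boldsymbol k}=\rho_i\ \ \forall i\Big\},\qquad L^\Box(\boldsymbol x)=\sum_{\boldsymbol k\in\bar{\mathcal K}}x_{\boldsymbol k}\log\frac{x_{\boldsymbol k}\prod_ik_i!}{e}\quad(0\log0=0).$$ **Lemma.** Assume that some $\boldsymbol x\in\mathcal X^\diamond$ has $x_{\boldsymbol 0^s}>0$ for all $s$. Then $L^\Box$ has a unique minimizer $\boldsymbol x^{*,\Box}$ on $\mathcal X^\diamond$, and there is $\epsilon>0$ such that, uniformly over all FSPs with $\boldsymbol x(0)\in\mathcal X^\Box$ and $\|\boldsymbol x(0)-\boldsymbol x^{*,\Box}\|\le\epsilon$,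 $$\boldsymbol x(t)\to\boldsymbol x^{*,\Box},\qquad t\to\infty;$$ that is, for every $\eta>0$ there is $T\ge 0$ such that $\|\boldsymbol x(t)-\boldsymbol x^{*,\Box}\|<\eta$ for all $t\ge T$ and all such FSPs. Here $\|\cdot\|$ is the Euclidean norm, and $\epsilon$ and $T$ do not depend on the sequence of scaling parameters $r$. -/

import Mathlib

open Filter Topology

open scoped Classical in
/-- The finite-server system with packing constraints.  `ι` is the set of customer types, `σ` the set
of server types; `conf s` is the finite set of allowed configurations (including the zero one) of a
server of type `s`. The arrival rates are `lam i * r`, a customer of type `i` has service rate `mu i`,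
and `h s` is the number of servers of type `s` per unit of the scaling parameter `r`. -/
structure PackingModel (ι σ : Type*) [Fintype ι] [Fintype σ] where
  conf : σ → Finset (ι → ℕ)
  conf_mono : ∀ s, ∀ k ∈ conf s, ∀ k' : ι → ℕ, k' ≤ k → k' ∈ conf s
  zero_mem : ∀ s, (0 : ι → ℕ) ∈ conf s
  unit_mem : ∀ i, ∃ s, (Pi.single i 1 : ι → ℕ) ∈ conf s
  lam : ι → ℝ
  lam_pos : ∀ i, 0 < lam i
  mu : ι → ℝ
  mu_pos : ∀ i, 0 < mu i
  h : σ → ℝ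
  h_pos : ∀ s, 0 < h s

noncomputable section

namespace PackingModel

variable {ι σ : Type*} [Fintype ι] [Fintype σ] (P : PackingModel ι σ)

/-- All server configurations `(k; s)`, the zero ones included. -/
abbrev Conf := (s : σ) × {k : ι → ℕ // k ∈ P.conf s}

variable {P} in
/-- The server type of a configuration. -/
def Conf.server (c : P.Conf) : σ := c.1

variable {P} in
/-- The numbers `k i` of customers of each type in a configuration. -/
def Conf.num (c : P.Conf) : ι → ℕ := c.2.1

/-- The nonzero configurations. -/
abbrev NZConf := {c : P.Conf // c.num ≠ 0}

/-- The edges `(k, i)`: configurations `k` such that `k - e_i` is again a configuration. As the sets of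
configurations are closed downwards, this just says that `k` holds a customer of type `i`. -/
abbrev Edge := {p : P.Conf × ι // 0 < p.1.num p.2}

instance : Fintype P.NZConf := Fintype.ofFinite _

instance : Fintype P.Edge := Fintype.ofFinite _

variable {P} in
/-- The configuration `k` of an edge `(k, i)`. -/
def Edge.upper (e : P.Edge) : P.Conf := e.1.1

variable {P} in
/-- The customer type `i` of an edge `(k, i)`. -/
def Edge.type (e : P.Edge) : ι := e.1.2

open scoped Classical in
variable {P} in
/-- The configuration `k - e_i` of an edge `(k, i)`. -/
def Edge.lower (e : P.Edge) : P.Conf :=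
  ⟨e.upper.server, e.upper.num - Pi.single e.type 1,
    P.conf_mono _ _ e.upper.2.2 _ tsub_le_self⟩

open scoped Classical in
/-- The configurations into which a further customer of type `i` fits. -/
def fits (i : ι) : Finset P.Conf :=
  Finset.univ.filter fun c => c.num + Pi.single i 1 ∈ P.conf c.server

/-! ### Fluid states and the equilibrium -/

/-- Fluid states: vectors indexed by the nonzero configurations, with the Euclidean norm. -/
abbrev State := EuclideanSpace ℝ P.NZConf

variable {P} in
open scoped Classical in
/-- The amount of empty servers of type `s` in the fluid state `x`. -/
def State.zero (x : P.State) (s : σ) : ℝ :=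
  P.h s - ∑ k ∈ Finset.univ.filter (fun k : P.NZConf => k.1.server = s), x k

variable {P} in
open scoped Classical in
/-- The fluid state completed by the amounts of empty servers. -/
def State.full (x : P.State) (c : P.Conf) : ℝ :=
  if hc : c.num ≠ 0 then x ⟨c, hc⟩ else State.zero x c.server

/-- The offered load of customer type `i`. -/
def rho (i : ι) : ℝ := P.lam i / P.mu i

open scoped Classical in
/-- The set of all fluid states of the finite-server system. -/
def box : Set P.State :=
  {x | (∀ k, 0 ≤ x k) ∧
    ∀ s, ∑ k ∈ Finset.univ.filter (fun k : P.NZConf => k.1.server = s), x k ≤ P.h s}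

/-- The fluid states holding exactly the amount `rho i` of customers of each type `i`. -/
def diamond : Set P.State :=
  {x | x ∈ P.box ∧ ∀ i, ∑ k : P.NZConf, (k.1.num i : ℝ) * x k = P.rho i}

/-- All offered load can be packed so that a positive amount of servers of each type is left empty. -/
def Feasible : Prop := ∃ x ∈ P.diamond, ∀ s, 0 < State.zero x s

/-- The objective, the sum of `x_k log (x_k c_k / e)` over all configurations `k`, the zero ones
included, where `c_k = ∏ i, k_i!` (and `0 log 0 = 0`). -/
def L (x : P.State) : ℝ :=
  ∑ c : P.Conf, State.full x c *
    Real.log (State.full x c * (∏ i, (Nat.factorial (c.num i) : ℝ)) / Real.exp 1)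

/-- `x` is an optimal solution of the problem of minimizing `L` over `diamond`. -/
def IsOptimal (x : P.State) : Prop := x ∈ P.diamond ∧ ∀ y ∈ P.diamond, P.L x ≤ P.L y

/-! ### The prelimit systems under GRAND-F, path by path -/

/-- The number of points of the sequence `T` in `[0, y]`: the value at `y` of the counting process
with points `T 0 < T 1 < …`. -/
def count (T : ℕ → ℝ) (y : ℝ) : ℕ := {m : ℕ | T m ≤ y}.ncard

/-- `T` lists the points of a realization of a Poisson process on `[0, ∞)`. -/
structure IsPointSeq (T : ℕ → ℝ) : Prop where
  pos : 0 < T 0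
  strictMono : StrictMono T
  tendsto : Tendsto T atTop atTop

/-- A realization of the primitive driving processes: `dep e` are the points of the unit-rate Poisson
process driving the departures along the edge `e`, `arr i` those of the unit-rate Poisson process
driving the arrivals of type `i`, and `xi i m` is the value, uniform in `[0, 1]` (and positive with
probability one), which determines the placement of the `m`-th customer of type `i`
(`m = 0, 1, 2, …`). -/
structure Driving where
  dep : P.Edge → ℕ → ℝ
  dep_seq : ∀ e, IsPointSeq (dep e)
  arr : ι → ℕ → ℝ
  arr_seq : ∀ i, IsPointSeq (arr i)
  xi : ι → ℕ → ℝ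
  xi_mem : ∀ i m, xi i m ∈ Set.Ioc (0 : ℝ) 1

/-- A sequence of systems with scaling parameters `r n`, increasing to infinity, and with `H n s`
servers of type `s`. If the numbers `h s * r n` are integers then `H n s = h s * r n` is allowed; in
general `H n s` is `h s * r n` up to an error `o(r n)`, for example by rounding. `index i` is the
arbitrary fixed order in which the configurations that fit a customer of type `i` are listed. -/
structure SystemSequence where
  r : ℕ → ℝ
  one_le_r : ∀ n, 1 ≤ r n
  r_strictMono : StrictMono r
  r_tendsto : Tendsto r atTop atTop
  H : ℕ → σ → ℕ
  H_tendsto : ∀ s, Tendsto (fun n => (H n s : ℝ) / r n) atTop (𝓝 (P.h s))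
  index : ι → P.Conf → ℕ
  index_inj : ∀ i, Set.InjOn (index i) (P.fits i : Set P.Conf)

open scoped Classical in
/-- In the state `X`, a customer of type `i` with placement value `z` is put into a server in
configuration `c`. With `X_(i)` the number of servers that fit the customer, the interval `(0, 1]` is
cut into consecutive intervals `(·, ·]` of lengths `X_c / X_(i)`, in the order given by `index`. If
`X_(i) = 0` then this holds for no `c`: the customer is blocked. -/
def Assigned (index : P.Conf → ℕ) (X : P.Conf → ℕ) (i : ι) (z : ℝ) (c : P.Conf) : Prop :=
  c ∈ P.fits i ∧
    ((∑ c' ∈ (P.fits i).filter (fun c' => index c' < index c), X c' : ℕ) : ℝ)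
      < z * ((∑ c' ∈ P.fits i, X c' : ℕ) : ℝ) ∧
    z * ((∑ c' ∈ P.fits i, X c' : ℕ) : ℝ)
      ≤ ((∑ c' ∈ (P.fits i).filter (fun c' => index c' ≤ index c), X c' : ℕ) : ℝ)

open scoped Classical in
/-- `X t c` (number of servers in configuration `c` at time `t`), `D t e` and `A t e` (numbers of
departures and of arrivals along the edge `e` in `[0, t]`) form a trajectory, driven by `ω`, of the
system with arrival rates `lam i * r` and with `H s` servers of type `s` under GRAND-F.
The `m`-th arrival of type `i` occurs at the time `ω.arr i m / (lam i * r)` and is placed according to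
the state immediately before that time. -/
structure IsTrajectory (ω : P.Driving) (index : ι → P.Conf → ℕ) (r : ℝ) (H : σ → ℕ)
    (X : ℝ → P.Conf → ℕ) (D A : ℝ → P.Edge → ℕ) : Prop where
  right_cont : ∀ t, 0 ≤ t → ∀ᶠ u in 𝓝[>] t, X u = X t
  left_lim : ∀ t, 0 < t → ∃ v, ∀ᶠ u in 𝓝[<] t, X u = v
  total : ∀ t, 0 ≤ t → ∀ s,
    ∑ c ∈ Finset.univ.filter (fun c : P.Conf => c.server = s), X t c = H s
  departures : ∀ t, 0 ≤ t → ∀ e : P.Edge,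
    D t e = count (ω.dep e)
      (∫ u in (0 : ℝ)..t, (X u e.upper : ℝ) * (e.upper.num e.type : ℝ) * P.mu e.type)
  arrivals : ∀ t, 0 ≤ t → ∀ e : P.Edge,
    A t e = {m : ℕ | ω.arr e.type m / (P.lam e.type * r) ≤ t ∧
      ∀ᶠ u in 𝓝[<] (ω.arr e.type m / (P.lam e.type * r)),
        P.Assigned (index e.type) (X u) e.type (ω.xi e.type m) e.lower}.ncard
  balance : ∀ t, 0 ≤ t → ∀ c : P.Conf,
    (X t c : ℤ) = X 0 c
      + (∑ e ∈ Finset.univ.filter (fun e : P.Edge => e.upper = c), (A t e : ℤ)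
        - ∑ e ∈ Finset.univ.filter (fun e : P.Edge => e.lower = c), (A t e : ℤ))
      - (∑ e ∈ Finset.univ.filter (fun e : P.Edge => e.upper = c), (D t e : ℤ)
        - ∑ e ∈ Finset.univ.filter (fun e : P.Edge => e.lower = c), (D t e : ℤ))

/-! ### Fluid sample paths -/

/-- Convergence on `[0, ∞)`, uniform on compact sets. -/
def TendstoUOC {E : Type*} [UniformSpace E] (F : ℕ → ℝ → E) (f : ℝ → E) : Prop :=
  ∀ T : ℝ, TendstoUniformlyOn F f atTop (Set.Icc 0 T)

open scoped Classical in
/-- The realization `ω` satisfies the functional strong laws of large numbers along the scaling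
parameters `r n`: `Π(r t) / r → t` for every driving Poisson process `Π`, and
`(1 / r) #{m ≤ ⌊r u⌋ : xi i m ≤ z} → u z` for every `i`, uniformly on compact sets of `t ≥ 0`, and of
`u ≥ 0`, `z ∈ [0, 1]`. -/
structure SatisfiesFSLLN (ω : P.Driving) (r : ℕ → ℝ) : Prop where
  dep : ∀ e, TendstoUOC (fun n t => (count (ω.dep e) (r n * t) : ℝ) / r n) (fun t => t)
  arr : ∀ i, TendstoUOC (fun n t => (count (ω.arr i) (r n * t) : ℝ) / r n) (fun t => t)
  xi : ∀ i, ∀ T : ℝ, TendstoUniformlyOn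
    (fun n (p : ℝ × ℝ) =>
      (((Finset.range ⌊r n * p.1⌋₊).filter (fun m => ω.xi i m ≤ p.2)).card : ℝ) / r n)
    (fun p => p.1 * p.2) atTop (Set.Icc 0 T ×ˢ Set.Icc 0 1)

/-- `(x, d, a)` is a fluid sample path of the sequence of systems `Q` under GRAND-F: a locally
Lipschitz limit, along a subsequence, of the fluid-scaled trajectories of the systems driven by
one realization of the primitive processes that satisfies the functional strong laws. -/
def IsFluidSamplePath (Q : P.SystemSequence) (x : ℝ → P.State) (d a : ℝ → P.Edge → ℝ) : Prop :=
  LocallyLipschitzOn (Set.Ici 0) x ∧ LocallyLipschitzOn (Set.Ici 0) d ∧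
  LocallyLipschitzOn (Set.Ici 0) a ∧
  ∃ ω : P.Driving, P.SatisfiesFSLLN ω Q.r ∧
  ∃ φ : ℕ → ℕ, StrictMono φ ∧
  ∃ (X : ℕ → ℝ → P.Conf → ℕ) (D A : ℕ → ℝ → P.Edge → ℕ),
    (∀ n, P.IsTrajectory ω Q.index (Q.r (φ n)) (Q.H (φ n)) (X n) (D n) (A n)) ∧
    TendstoUOC
      (fun n t => WithLp.toLp 2 (fun k : P.NZConf => (X n t k.1 : ℝ) / Q.r (φ n))) x ∧
    TendstoUOC (fun n t e => (D n t e : ℝ) / Q.r (φ n)) d ∧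
    TendstoUOC (fun n t e => (A n t e : ℝ) / Q.r (φ n)) a

end PackingModel

end

/-!
The proof is by a Lyapunov function for the fluid dynamics near the optimum.

*The optimum.* Minimizing the convex dual function of the problem yields a state `xs` in product
form, `x_k = exp (α_s + ∑ i, ν_i k_i) / ∏ i, k_i!`, that carries exactly the offered load
(`Feasible.exists_productForm`). Hence on `diamond` the objective `L` is, up to a constant, the
relative entropy with respect to `xs` (`L_eq_relEntropy`), and `xs` is the unique minimizer.

*The fluid dynamics.* Wherever every customer type finds room, all coordinates of a fluid sample
path have right derivatives: along an edge `(k, i)` customers arrive at the rate `λ_i x_{k - e_i}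
/ x_(i)` and depart at the rate `k_i μ_i x_k` (`IsFluidLimit.hasDerivWithinAt_full`). Departures
are the limit of time-changed counting processes. For arrivals, the placement intervals of the
prelimit systems are squeezed, during a short period, between two fixed intervals, to which the
law of large numbers for the placement variables applies.

*The Lyapunov function.* In terms of the ratios `u_k = x_k / xs_k`, the detailed balance of `xs`
gives the relative entropy the derivative `-∑ w (log (θ_i u_{k - e_i}) - log u_k) (θ_i u_{k - e_i}
- u_k)`, a sum over the edges with positive weights `w` and with `θ_i = xs_(i) / x_(i)`, plus an
error `∑ i, log θ_i (λ_i - μ_i y_i)`, where `y_i` is the load of type `i`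
(`sum_log_mul_netFlow_flux`). The loads satisfy `y_i' = λ_i - μ_i y_i` by themselves, so that
adding `2 ∑ i, |y_i - ρ_i|` to the relative entropy absorbs the error where `|log θ_i| ≤ 1`. The
resulting rate of decrease vanishes at `xs` only (`eq_of_dissipation_eq_zero`): if `u_k = θ_i u_{k
- e_i}` along all edges then `log u` is a combination of the constraints, so `∑ (x_k - xs_k) log
u_k = 0`, whose terms are nonnegative. As right derivatives suffice for Lyapunov's argument,
`exists_uniform_attraction` concludes; its constants depend on the Lyapunov function and its rate
alone, whence the uniformity over all fluid sample paths.
-/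

/-! ### Uniform asymptotic stability -/

/-- A function whose right derivatives are at most `-c` decreases at least at the rate `c`. -/
theorem le_sub_mul_of_hasDerivWithinAt_Ici {f : ℝ → ℝ} {a b c : ℝ} (hab : a ≤ b)
    (hf : ContinuousOn f (Set.Icc a b))
    (hd : ∀ t ∈ Set.Ico a b, ∃ f', f' ≤ -c ∧ HasDerivWithinAt f f' (Set.Ici t) t) :
    f b ≤ f a - c * (b - a) := by
  choose! f' hle hderiv using hd
  have hB : ∀ x : ℝ, HasDerivAt (fun t => f a - c * (t - a)) (-c) x := fun x => by
    simpa using (((hasDerivAt_id x).sub_const a).const_mul c).const_sub (f a)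
  exact image_le_of_deriv_right_le_deriv_boundary (B := fun t => f a - c * (t - a))
    (B' := fun _ => -c) hf hderiv (by simp)
    (fun x _ => (hB x).continuousAt.continuousWithinAt)
    (fun x _ => (hB x).hasDerivWithinAt) hle (Set.right_mem_Icc.2 hab)

/-- Lyapunov's theorem on asymptotic stability, uniform over all curves in a closed set `S` along
which `W` decreases at least at the rate `g` as long as they are within distance `R` of `p`. -/
theorem exists_uniform_attraction {E : Type*} [NormedAddCommGroup E] [ProperSpace E] {S : Set E}
    (hS : IsClosed S) {p : E} (hpS : p ∈ S) {R : ℝ} (hR : 0 < R) {W g : E → ℝ}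
    (hW : ContinuousOn W (S ∩ Metric.closedBall p R))
    (hg : ContinuousOn g (S ∩ Metric.closedBall p R))
    (hWp : W p = 0) (hgp : 0 ≤ g p)
    (hWpos : ∀ x ∈ S ∩ Metric.closedBall p R, x ≠ p → 0 < W x)
    (hgpos : ∀ x ∈ S ∩ Metric.closedBall p R, x ≠ p → 0 < g x) :
    ∃ ε : ℝ, 0 < ε ∧ ∀ η : ℝ, 0 < η → ∃ T : ℝ, 0 ≤ T ∧ ∀ u : ℝ → E,
      ContinuousOn u (Set.Ici 0) → (∀ t, 0 ≤ t → u t ∈ S) →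
      (∀ t, 0 ≤ t → u t ∈ Metric.closedBall p R →
        ∃ w', w' ≤ -g (u t) ∧ HasDerivWithinAt (fun s => W (u s)) w' (Set.Ici t) t) →
      ‖u 0 - p‖ ≤ ε → ∀ t, T ≤ t → ‖u t - p‖ < η := by
  have hKc : IsCompact (S ∩ Metric.closedBall p R) :=
    (isCompact_closedBall p R).inter_left hS
  have hWnn : ∀ x ∈ S ∩ Metric.closedBall p R, 0 ≤ W x := fun x hx => by
    by_cases h : x = p
    · rw [h, hWp]
    · exact (hWpos x hx h).le
  have hgnn : ∀ x ∈ S ∩ Metric.closedBall p R, 0 ≤ g x := fun x hx => by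
    by_cases h : x = p
    · rwa [h]
    · exact (hgpos x hx h).le
  -- the level below which `W` confines a curve to the ball of radius `η`
  have hlevel : ∀ η : ℝ, 0 < η → ∃ m : ℝ, 0 < m ∧
      ∀ x ∈ S ∩ Metric.closedBall p R, η ≤ ‖x - p‖ → m ≤ W x := fun η hη => by
    have hcl : IsClosed {x : E | η ≤ ‖x - p‖} :=
      isClosed_le continuous_const (continuous_id.sub continuous_const).norm
    obtain ⟨m, hm, hle⟩ := (hKc.inter_right hcl).exists_forall_le'
      (hW.mono Set.inter_subset_left) (fun x hx => hWpos x hx.1 (by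
        rintro rfl
        have : η ≤ ‖x - x‖ := hx.2
        rw [sub_self, norm_zero] at this
        linarith))
    exact ⟨m, hm, fun x hx hx' => hle x ⟨hx, hx'⟩⟩
  obtain ⟨m, hm, hmle⟩ := hlevel R hR
  have hpK : p ∈ S ∩ Metric.closedBall p R := ⟨hpS, Metric.mem_closedBall_self hR.le⟩
  have hnear : ∃ ε : ℝ, 0 < ε ∧ ∀ x ∈ S ∩ Metric.closedBall p R, ‖x - p‖ ≤ ε → W x < m := by
    have := (hW p hpK).eventually (Iio_mem_nhds (hWp.symm ▸ hm : W p < m))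
    obtain ⟨ε, hε, h⟩ := Metric.mem_nhdsWithin_iff.1 this
    refine ⟨ε / 2, half_pos hε, fun x hx hxε => h ⟨?_, hx⟩⟩
    rw [Metric.mem_ball, dist_eq_norm]
    linarith
  obtain ⟨ε₁, hε₁, hnear⟩ := hnear
  refine ⟨min ε₁ (R / 2), lt_min hε₁ (half_pos hR), fun η hη => ?_⟩
  obtain ⟨mη, hmη, hmηle⟩ := hlevel η hη
  obtain ⟨c, hc, hcle⟩ : ∃ c : ℝ, 0 < c ∧ ∀ x ∈ S ∩ Metric.closedBall p R, mη ≤ W x → c ≤ g x := by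
    have hcl : IsClosed (S ∩ Metric.closedBall p R ∩ W ⁻¹' Set.Ici mη) :=
      hW.preimage_isClosed_of_isClosed hKc.isClosed isClosed_Ici
    obtain ⟨c, hc, hle⟩ := (hKc.of_isClosed_subset hcl Set.inter_subset_left).exists_forall_le'
      (hg.mono Set.inter_subset_left) (fun x hx => hgpos x hx.1 (by
        rintro rfl
        have : mη ≤ W x := hx.2
        linarith))
    exact ⟨c, hc, fun x hx hx' => hle x ⟨hx, hx'⟩⟩
  refine ⟨m / c, by positivity, fun u hu huS hderiv hu0 => ?_⟩
  have hKof : ∀ t, 0 ≤ t → ‖u t - p‖ ≤ R → u t ∈ S ∩ Metric.closedBall p R := fun t ht h =>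
    ⟨huS t ht, by rwa [Metric.mem_closedBall, dist_eq_norm]⟩
  have hu0R : ‖u 0 - p‖ < R := lt_of_le_of_lt (hu0.trans (min_le_right _ _)) (by linarith)
  have hW0 : W (u 0) < m := hnear _ (hKof 0 le_rfl hu0R.le) (hu0.trans (min_le_left _ _))
  have hdecr : ∀ a b k : ℝ, 0 ≤ a → a ≤ b → (∀ t ∈ Set.Icc a b, ‖u t - p‖ ≤ R) →
      (∀ t ∈ Set.Ico a b, k ≤ g (u t)) → W (u b) ≤ W (u a) - k * (b - a) := by
    intro a b k ha hab hball hk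
    refine le_sub_mul_of_hasDerivWithinAt_Ici (f := fun s => W (u s)) hab ?_ fun t ht => ?_
    · exact hW.comp (hu.mono fun t ht => ha.trans ht.1)
        fun t ht => hKof t (ha.trans ht.1) (hball t ht)
    · have h0 : 0 ≤ t := ha.trans ht.1
      obtain ⟨w', hw', hd⟩ := hderiv t h0 (hKof t h0 (hball t ⟨ht.1, ht.2.le⟩)).2
      exact ⟨w', hw'.trans (neg_le_neg (hk t ht)), hd⟩
  -- a curve cannot reach the sphere of radius `R`, on which `W` is at least `m`
  have hstay : ∀ t, 0 ≤ t → ‖u t - p‖ < R := by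
    by_contra! hcon
    obtain ⟨t₀, ht₀, hbad⟩ := hcon
    have hcont : ContinuousOn (fun t => ‖u t - p‖) (Set.Ici 0) :=
      (hu.sub continuousOn_const).norm
    set B : Set ℝ := Set.Ici 0 ∩ (fun t => ‖u t - p‖) ⁻¹' Set.Ici R with hB
    have hBcl : IsClosed B := hcont.preimage_isClosed_of_isClosed isClosed_Ici isClosed_Ici
    have hBne : B.Nonempty := ⟨t₀, ht₀, hbad⟩
    have hBbdd : BddBelow B := ⟨0, fun t ht => ht.1⟩
    have hmem : sInf B ∈ B := hBcl.csInf_mem hBne hBbdd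
    set τ := sInf B with hτ
    have hlt : ∀ t, 0 ≤ t → t < τ → ‖u t - p‖ < R := fun t h0 h => by
      by_contra! hge
      exact absurd (csInf_le hBbdd (show t ∈ B from ⟨h0, hge⟩)) (not_le.2 h)
    have hτ0 : 0 < τ := lt_of_le_of_ne hmem.1 (by
      intro h0
      have : R ≤ ‖u τ - p‖ := hmem.2
      rw [← h0] at this
      linarith)
    have hτR : ‖u τ - p‖ ≤ R := by
      have hcw : Tendsto (fun t => ‖u t - p‖) (𝓝[<] τ) (𝓝 ‖u τ - p‖) :=
        ((hcont τ hmem.1).mono_left (nhdsWithin_le_of_mem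
          (mem_of_superset (Ioo_mem_nhdsLT hτ0) fun t ht => ht.1.le)))
      refine le_of_tendsto hcw ?_
      filter_upwards [Ioo_mem_nhdsLT hτ0] with t ht using (hlt t ht.1.le ht.2).le
    have hin : ∀ t ∈ Set.Icc 0 τ, ‖u t - p‖ ≤ R := fun t ht => by
      rcases ht.2.lt_or_eq with h | h
      · exact (hlt t ht.1 h).le
      · rwa [h]
    have h1 := hdecr 0 τ 0 le_rfl hτ0.le hin
      fun t ht => hgnn _ (hKof t ht.1 (hin t ⟨ht.1, ht.2.le⟩))
    have h2 := hmle (u τ) (hKof τ hτ0.le hτR) hmem.2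
    linarith
  have hanti : ∀ a b, 0 ≤ a → a ≤ b → W (u b) ≤ W (u a) := fun a b ha hab => by
    have := hdecr a b 0 ha hab (fun t ht => (hstay t (ha.trans ht.1)).le)
      fun t ht => hgnn _ (hKof t (ha.trans ht.1) (hstay t (ha.trans ht.1)).le)
    linarith
  have hT0 : 0 ≤ m / c := by positivity
  have hWT : W (u (m / c)) < mη := by
    by_contra! hge
    have h1 := hdecr 0 (m / c) c le_rfl hT0 (fun t ht => (hstay t ht.1).le) fun t ht =>
      hcle _ (hKof t ht.1 (hstay t ht.1).le) (hge.trans (hanti t _ ht.1 ht.2.le))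
    have h2 : c * (m / c - 0) = m := by field_simp; ring
    have h3 := hWnn _ (hKof _ hT0 (hstay _ hT0).le)
    linarith
  intro t ht
  by_contra! hge
  have h1 := hmηle _ (hKof t (hT0.trans ht) (hstay t (hT0.trans ht)).le) hge
  have h2 := hanti _ t hT0 ht
  linarith

noncomputable section

namespace PackingModel

variable {ι σ : Type*} [Fintype ι] [Fintype σ] {P : PackingModel ι σ}

/-! ### Configurations, edges and completed states -/

variable (P) in
/-- The configuration of an empty server of type `s`. -/
def emptyConf (s : σ) : P.Conf := ⟨s, 0, P.zero_mem s⟩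

theorem sum_conf (g : P.Conf → ℝ) :
    ∑ c, g c = ∑ k : P.NZConf, g k.1 + ∑ s, g (P.emptyConf s) := by
  classical
  rw [← Fintype.sum_subtype_add_sum_subtype (fun c : P.Conf => c.num ≠ 0) g]
  congr 1
  · exact Finset.sum_congr (by ext; simp) fun _ _ => rfl
  · refine (Fintype.sum_bijective
      (fun s => (⟨P.emptyConf s, fun h => h rfl⟩ : {c : P.Conf // ¬ c.num ≠ 0})) ⟨?_, ?_⟩ _ _
      fun s => rfl).symm
    · intro s s' h
      exact congrArg Sigma.fst (congrArg Subtype.val h)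
    · rintro ⟨⟨s, k, hk⟩, h⟩
      obtain rfl : k = 0 := not_not.1 h
      exact ⟨s, rfl⟩

theorem State.full_nz (x : P.State) (k : P.NZConf) : State.full x k.1 = x k := dif_pos k.2

theorem State.full_emptyConf (x : P.State) (s : σ) :
    State.full x (P.emptyConf s) = State.zero x s := dif_neg (fun h => h rfl)

theorem State.full_of_num_eq_zero (x : P.State) {c : P.Conf} (hc : c.num = 0) :
    State.full x c = State.zero x c.server := dif_neg (not_not.2 hc)

theorem State.full_injective : Function.Injective (State.full : P.State → P.Conf → ℝ) := by
  intro x y h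
  ext k
  rw [← State.full_nz, ← State.full_nz, h]

open scoped Classical in
theorem sum_filter_server (g : P.Conf → ℝ) (s : σ) :
    ∑ c with Conf.server c = s, g c
      = ∑ k ∈ Finset.univ.filter (fun k : P.NZConf => k.1.server = s), g k.1
        + g (P.emptyConf s) := by
  rw [Finset.sum_filter, sum_conf, Finset.sum_filter]
  congr 1
  rw [Finset.sum_eq_single s]
  · exact if_pos rfl
  · intro s' _ hs'
    exact if_neg hs'
  · simp

open scoped Classical in
theorem State.sum_full_server (x : P.State) (s : σ) :
    ∑ c with Conf.server c = s, State.full x c = P.h s := by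
  rw [sum_filter_server, State.full_emptyConf, State.zero]
  simp_rw [State.full_nz]
  ring

variable (P) in
/-- The fluid state with given amounts of all nonzero configurations. -/
def ofFull (v : P.Conf → ℝ) : P.State := WithLp.toLp 2 fun k => v k.1

open scoped Classical in
theorem full_ofFull {v : P.Conf → ℝ} (hv : ∀ s, ∑ c with Conf.server c = s, v c = P.h s) :
    State.full (P.ofFull v) = v := by
  ext c
  by_cases hc : c.num = 0
  · obtain ⟨s, k, hk⟩ := c
    obtain rfl : k = 0 := hc
    change State.full (P.ofFull v) (P.emptyConf s) = v (P.emptyConf s)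
    rw [State.full_emptyConf, State.zero, ← hv s, sum_filter_server]
    simp [ofFull]
  · exact State.full_nz (P.ofFull v) ⟨c, hc⟩

theorem State.continuous_full (c : P.Conf) : Continuous fun x : P.State => State.full x c := by
  by_cases hc : c.num = 0
  · simp_rw [State.full_of_num_eq_zero _ hc, State.zero]
    fun_prop
  · simp_rw [fun x : P.State => State.full_nz x ⟨c, hc⟩]
    fun_prop

theorem mem_box_iff {x : P.State} : x ∈ P.box ↔ ∀ c, 0 ≤ State.full x c := by
  constructor
  · rintro ⟨h0, h1⟩ c
    by_cases hc : c.num = 0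
    · rw [State.full_of_num_eq_zero _ hc]
      exact sub_nonneg.2 (h1 _)
    · rw [State.full_nz x ⟨c, hc⟩]
      exact h0 _
  · intro h
    refine ⟨fun k => State.full_nz x k ▸ h k.1, fun s => ?_⟩
    have := h (P.emptyConf s)
    rw [State.full_emptyConf] at this
    exact sub_nonneg.1 this

theorem isClosed_box : IsClosed P.box := by
  have : P.box = ⋂ c, {x : P.State | 0 ≤ State.full x c} := by
    ext x
    simp [mem_box_iff]
  rw [this]
  exact isClosed_iInter fun c => isClosed_le continuous_const (State.continuous_full c)

/-- The amount of customers of type `i` in the fluid state `x`. -/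
def State.load (x : P.State) (i : ι) : ℝ := ∑ c : P.Conf, (c.num i : ℝ) * State.full x c

theorem State.load_eq (x : P.State) (i : ι) :
    State.load x i = ∑ k : P.NZConf, (k.1.num i : ℝ) * x k := by
  rw [State.load, sum_conf]
  simp [State.full_nz, emptyConf, Conf.num]

theorem State.continuous_load (i : ι) : Continuous fun x : P.State => State.load x i :=
  continuous_finsetSum _ fun c _ => (State.continuous_full c).const_mul _

theorem mem_diamond_iff {x : P.State} :
    x ∈ P.diamond ↔ x ∈ P.box ∧ ∀ i, State.load x i = P.rho i := by
  simp_rw [State.load_eq]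
  rfl

theorem rho_pos (i : ι) : 0 < P.rho i := div_pos (P.lam_pos i) (P.mu_pos i)

theorem rho_mul_mu (i : ι) : P.rho i * P.mu i = P.lam i := div_mul_cancel₀ _ (P.mu_pos i).ne'

theorem Edge.num_upper (e : P.Edge) [DecidableEq ι] :
    e.upper.num = e.lower.num + Pi.single e.type 1 := by
  classical
  have h : (Pi.single e.type 1 : ι → ℕ) ≤ e.upper.num := by
    intro j
    by_cases hj : j = e.type
    · subst hj
      simpa using (show 1 ≤ e.upper.num e.type from e.2)
    · simp [hj]
  have := tsub_add_cancel_of_le h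
  convert this.symm using 1
  simp only [Edge.lower, Conf.num]
  congr!

theorem Edge.server_lower (e : P.Edge) : e.lower.server = e.upper.server := rfl

theorem Edge.num_upper_type (e : P.Edge) : e.upper.num e.type = e.lower.num e.type + 1 := by
  classical
  rw [e.num_upper]
  simp

theorem Edge.num_upper_of_ne (e : P.Edge) {i : ι} (hi : i ≠ e.type) :
    e.upper.num i = e.lower.num i := by
  classical
  rw [e.num_upper]
  simp [hi]

theorem Edge.lower_mem_fits (e : P.Edge) : e.lower ∈ P.fits e.type := by
  classical
  simp only [fits, Finset.mem_filter, Finset.mem_univ, true_and]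
  have h : e.lower.num + Pi.single e.type 1 = e.upper.num := e.num_upper.symm
  rw [h]
  exact e.upper.2.2

theorem Conf.ext_num {c c' : P.Conf} (hs : c.server = c'.server) (hn : c.num = c'.num) :
    c = c' := by
  obtain ⟨s, k, hk⟩ := c
  obtain ⟨s', k', hk'⟩ := c'
  obtain rfl : s = s' := hs
  obtain rfl : k = k' := hn
  rfl

open scoped Classical in
/-- Removing a customer of type `i` matches the edges of type `i` with the configurations into
which such a customer fits. -/
theorem sum_edge_lower (i : ι) (g : P.Conf → ℝ) :
    ∑ e with Edge.type e = i, g (Edge.lower e) = ∑ c ∈ P.fits i, g c := by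
  refine Finset.sum_bij (fun e _ => Edge.lower e) ?_ ?_ ?_ fun _ _ => rfl
  · intro e he
    rw [Finset.mem_filter] at he
    rw [← he.2]
    exact e.lower_mem_fits
  · intro e he e' he' h
    rw [Finset.mem_filter] at he he'
    refine Subtype.ext (Prod.ext (Conf.ext_num ?_ ?_) (he.2.trans he'.2.symm))
    · change e.upper.server = e'.upper.server
      rw [← e.server_lower, h, e'.server_lower]
    · change e.upper.num = e'.upper.num
      rw [e.num_upper, h, e'.num_upper, he.2, he'.2]
  · intro c hc
    simp only [fits, Finset.mem_filter, Finset.mem_univ, true_and] at hc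
    refine ⟨⟨(⟨c.server, c.num + Pi.single i 1, hc⟩, i), ?_⟩, ?_, ?_⟩
    · change 0 < (c.num + Pi.single i 1 : ι → ℕ) i
      simp
    · exact Finset.mem_filter.2 ⟨Finset.mem_univ _, rfl⟩
    · refine Conf.ext_num rfl ?_
      change c.num + Pi.single i 1 - Pi.single i 1 = c.num
      simp

open scoped Classical in
theorem sum_edge_upper (i : ι) (g : P.Conf → ℝ) :
    ∑ e with Edge.type e = i, ((Edge.upper e).num i : ℝ) * g (Edge.upper e)
      = ∑ c : P.Conf, (c.num i : ℝ) * g c := by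
  rw [← Finset.sum_filter_of_ne (s := Finset.univ) (p := fun c : P.Conf => 0 < c.num i)]
  · refine Finset.sum_bij (fun e _ => Edge.upper e) ?_ ?_ ?_ fun _ _ => rfl
    · intro e he
      rw [Finset.mem_filter] at he
      rw [Finset.mem_filter, ← he.2]
      exact ⟨Finset.mem_univ _, e.2⟩
    · intro e he e' he' h
      rw [Finset.mem_filter] at he he'
      exact Subtype.ext (Prod.ext h (he.2.trans he'.2.symm))
    · intro c hc
      exact ⟨⟨(c, i), (Finset.mem_filter.1 hc).2⟩,
        Finset.mem_filter.2 ⟨Finset.mem_univ _, rfl⟩, rfl⟩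
  · intro c _ hne
    by_contra h0
    exact hne (by simp [Nat.eq_zero_of_not_pos h0])

open scoped Classical in
/-- The net inflow into each configuration under a flux along the edges, an edge leading from its
lower to its upper configuration. -/
def netFlow (f : P.Edge → ℝ) (c : P.Conf) : ℝ :=
  ∑ e with Edge.upper e = c, f e - ∑ e with Edge.lower e = c, f e

theorem sum_mul_netFlow (g : P.Conf → ℝ) (f : P.Edge → ℝ) :
    ∑ c, g c * netFlow f c = ∑ e : P.Edge, (g e.upper - g e.lower) * f e := by
  classical
  have key : ∀ F : P.Edge → P.Conf,
      ∑ c, g c * ∑ e with F e = c, f e = ∑ e, g (F e) * f e := fun F => by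
    rw [← Finset.sum_fiberwise Finset.univ F]
    refine Finset.sum_congr rfl fun c _ => ?_
    rw [Finset.mul_sum]
    refine Finset.sum_congr rfl fun e he => ?_
    rw [(Finset.mem_filter.1 he).2]
  simp_rw [netFlow, mul_sub, Finset.sum_sub_distrib, sub_mul]
  rw [Finset.sum_sub_distrib, ← key, ← key]

open scoped Classical in
theorem sum_num_mul_netFlow (i : ι) (f : P.Edge → ℝ) :
    ∑ c : P.Conf, (c.num i : ℝ) * netFlow f c = ∑ e with Edge.type e = i, f e := by
  rw [sum_mul_netFlow (fun c => (c.num i : ℝ)), Finset.sum_filter]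
  refine Finset.sum_congr rfl fun e _ => ?_
  split_ifs with h
  · subst h
    rw [e.num_upper_type]
    push_cast
    ring
  · rw [e.num_upper_of_ne (Ne.symm h)]
    ring

/-! ### The optimal state in product form -/

/-- If all load can be packed with empty servers of each type left over, then it can be packed with
a positive amount of servers in every configuration: move a little towards the vector `v` which
consists of a small amount `b` of each nonzero configuration and of singly occupied servers that make
up for the remaining load. This vector may use too many servers, but the empty ones leave room. -/
theorem Feasible.exists_pos (hP : P.Feasible) :
    ∃ z : P.State, (∀ c, 0 < State.full z c) ∧ ∀ i, State.load z i = P.rho i := by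
  classical
  obtain ⟨x, ⟨hbox, hload⟩, hzero⟩ := hP
  choose srv hsrv using P.unit_mem
  have hne : ∀ j, Conf.num (⟨srv j, Pi.single j 1, by convert hsrv j⟩ : P.Conf) ≠ 0 := fun j h => by
    have := congrFun h j
    change (Pi.single j 1 : ι → ℕ) j = 0 at this
    simp at this
  let unit : ι → P.NZConf := fun j => ⟨⟨srv j, Pi.single j 1, by convert hsrv j⟩, hne j⟩
  have hunit : ∀ j i, ((unit j).1.num i : ℝ) = if i = j then 1 else 0 := fun j i => by
    change (((Pi.single j 1 : ι → ℕ) i : ℕ) : ℝ) = _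
    rw [Pi.single_apply]
    split_ifs <;> simp
  let m : ι → ℝ := fun i => ∑ k : P.NZConf, (k.1.num i : ℝ)
  obtain ⟨b, hbpos, hb⟩ : ∃ b : ℝ, 0 < b ∧ ∀ i, b * m i < P.rho i := by
    have h : ∀ᶠ b : ℝ in 𝓝[>] 0, ∀ i, b * m i < P.rho i := by
      refine eventually_all.2 fun i => ?_
      have : Tendsto (fun b : ℝ => b * m i) (𝓝[>] 0) (𝓝 (0 * m i)) :=
        ((continuous_id.mul continuous_const).tendsto 0).mono_left nhdsWithin_le_nhds
      rw [zero_mul] at this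
      exact this.eventually_lt_const (rho_pos i)
    obtain ⟨b, hb, hb0⟩ := (h.and self_mem_nhdsWithin).exists
    exact ⟨b, hb0, hb⟩
  let v : P.State := WithLp.toLp 2 fun k =>
    b + ∑ j, if k = unit j then P.rho j - b * m j else 0
  have hv : ∀ k, 0 < v k := fun k => add_pos_of_pos_of_nonneg hbpos
    (Finset.sum_nonneg fun j _ => by split_ifs <;> linarith [hb j])
  have hvload : ∀ i, ∑ k : P.NZConf, (k.1.num i : ℝ) * v k = P.rho i := fun i => by
    have h1 : ∀ k : P.NZConf, (k.1.num i : ℝ) * v k = b * (k.1.num i : ℝ)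
        + ∑ j, if k = unit j then (k.1.num i : ℝ) * (P.rho j - b * m j) else 0 := fun k => by
      change (k.1.num i : ℝ) * (b + ∑ j, _) = _
      rw [mul_add, Finset.mul_sum, mul_comm]
      simp_rw [mul_ite, mul_zero]
    simp_rw [h1]
    rw [Finset.sum_add_distrib, ← Finset.mul_sum, Finset.sum_comm]
    simp_rw [Finset.sum_ite_eq' Finset.univ, Finset.mem_univ, if_true, hunit, ite_mul, one_mul,
      zero_mul]
    rw [Finset.sum_ite_eq Finset.univ]
    simp [m]
  have hcont : ∀ s, Continuous fun t : ℝ => State.zero (x + t • (v - x)) s := fun s => by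
    unfold State.zero
    fun_prop
  have hev : ∀ᶠ t : ℝ in 𝓝[>] 0, ∀ s, 0 < State.zero (x + t • (v - x)) s := by
    refine eventually_all.2 fun s => ?_
    have : Tendsto (fun t : ℝ => State.zero (x + t • (v - x)) s) (𝓝[>] 0)
        (𝓝 (State.zero (x + (0 : ℝ) • (v - x)) s)) :=
      ((hcont s).tendsto 0).mono_left nhdsWithin_le_nhds
    rw [zero_smul, add_zero] at this
    exact this.eventually_const_lt (hzero s)
  obtain ⟨t, hts, ht0, ht1⟩ :=
    (hev.and (Ioo_mem_nhdsGT (one_pos : (0 : ℝ) < 1))).exists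
  refine ⟨x + t • (v - x), fun c => ?_, fun i => ?_⟩
  · by_cases hc : c.num = 0
    · rw [State.full_of_num_eq_zero _ hc]
      exact hts _
    · rw [State.full_nz _ ⟨c, hc⟩]
      have h1 := hbox.1 ⟨c, hc⟩
      have h2 := mul_pos ht0 (hv ⟨c, hc⟩)
      have h3 := mul_nonneg (sub_nonneg.2 ht1.le) h1
      simp only [PiLp.add_apply, PiLp.smul_apply, PiLp.sub_apply, smul_eq_mul]
      nlinarith
  · rw [State.load_eq]
    have h1 : ∀ k : P.NZConf, (k.1.num i : ℝ) * (x + t • (v - x)) k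
        = (1 - t) * ((k.1.num i : ℝ) * x k) + t * ((k.1.num i : ℝ) * v k) := fun k => by
      simp only [PiLp.add_apply, PiLp.smul_apply, PiLp.sub_apply, smul_eq_mul]
      ring
    simp_rw [h1]
    rw [Finset.sum_add_distrib, ← Finset.mul_sum, ← Finset.mul_sum, hvload, hload]
    ring

/-- The weight `c_k = ∏ i, k_i!` of a configuration. -/
def Conf.weight (c : P.Conf) : ℝ := ∏ i, (Nat.factorial (c.num i) : ℝ)

theorem Conf.weight_pos (c : P.Conf) : 0 < c.weight :=
  Finset.prod_pos fun i _ => by exact_mod_cast Nat.factorial_pos _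

theorem Edge.weight_upper (e : P.Edge) :
    e.upper.weight = e.upper.num e.type * e.lower.weight := by
  classical
  rw [Conf.weight, Conf.weight, ← Finset.mul_prod_erase _ _ (Finset.mem_univ e.type),
    ← Finset.mul_prod_erase _ _ (Finset.mem_univ e.type), ← mul_assoc]
  congr 1
  · rw [e.num_upper_type, Nat.factorial_succ]
    push_cast
    ring
  · refine Finset.prod_congr rfl fun i hi => ?_
    rw [e.num_upper_of_ne (Finset.ne_of_mem_erase hi)]

variable (P) in
/-- The logarithmic weights `α_s + ∑ i, ν_i k_i` given by multipliers `α` of the server constraints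
and `ν` of the load constraints. -/
def multiplierMap : (σ → ℝ) × (ι → ℝ) →ₗ[ℝ] (P.Conf → ℝ) where
  toFun q c := q.1 c.server + ∑ i, q.2 i * c.num i
  map_add' q q' := by
    ext c
    simp only [Prod.fst_add, Prod.snd_add, Pi.add_apply, add_mul, Finset.sum_add_distrib]
    ring
  map_smul' t q := by
    ext c
    simp only [Prod.smul_fst, Prod.smul_snd, Pi.smul_apply, smul_eq_mul, RingHom.id_apply, mul_add,
      Finset.mul_sum, mul_assoc]

open scoped Classical in
theorem sum_mul_multiplierMap (v : P.Conf → ℝ) (q : (σ → ℝ) × (ι → ℝ)) :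
    ∑ c, v c * P.multiplierMap q c = ∑ s, q.1 s * ∑ c with Conf.server c = s, v c
      + ∑ i, q.2 i * ∑ c : P.Conf, (c.num i : ℝ) * v c := by
  have h1 : ∑ c, v c * q.1 c.server = ∑ s, q.1 s * ∑ c with Conf.server c = s, v c := by
    rw [← Finset.sum_fiberwise Finset.univ Conf.server]
    refine Finset.sum_congr rfl fun s _ => ?_
    rw [Finset.mul_sum]
    refine Finset.sum_congr rfl fun c hc => ?_
    rw [(Finset.mem_filter.1 hc).2, mul_comm]
  have h2 : ∑ c : P.Conf, v c * ∑ i, q.2 i * c.num i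
      = ∑ i, q.2 i * ∑ c : P.Conf, (c.num i : ℝ) * v c := by
    simp_rw [Finset.mul_sum]
    rw [Finset.sum_comm]
    refine Finset.sum_congr rfl fun i _ => Finset.sum_congr rfl fun c _ => ?_
    ring
  rw [← h1, ← h2, ← Finset.sum_add_distrib]
  exact Finset.sum_congr rfl fun c _ => mul_add _ _ _

/-- For `w, z > 0` the convex function `e ^ t / w - z t` grows at least linearly. -/
theorem exists_forall_mul_abs_sub_le {w z : ℝ} (hw : 0 < w) (hz : 0 < z) :
    ∃ C : ℝ, ∀ t : ℝ, z * |t| - C ≤ Real.exp t / w - z * t := by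
  set b := Real.log (2 * z * w) with hb
  have heb : Real.exp b = 2 * z * w := Real.exp_log (by positivity)
  refine ⟨2 * z * |b - 1|, fun t => ?_⟩
  have hpos : 0 < Real.exp t / w := by positivity
  rcases le_total t 0 with ht | ht
  · rw [abs_of_nonpos ht]
    have : 0 ≤ 2 * z * |b - 1| := by positivity
    linarith
  · rw [abs_of_nonneg ht]
    -- the tangent of the exponential function at the point where its slope is `2 z w`
    have h1 : Real.exp t = 2 * z * w * Real.exp (t - b) := by
      rw [← heb, ← Real.exp_add]
      ring_nf
    have h2 : Real.exp t / w = 2 * z * Real.exp (t - b) := by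
      rw [h1]
      field_simp
    have h3 := mul_le_mul_of_nonneg_left (Real.add_one_le_exp (t - b)) (by positivity : 0 ≤ 2 * z)
    have h4 := mul_le_mul_of_nonneg_left (le_abs_self (b - 1)) (by positivity : 0 ≤ 2 * z)
    rw [h2]
    nlinarith

/-- There is a state in product form that carries exactly the offered load. It is obtained from a
minimizer of the convex dual function `∑ c, (e ^ l_c / c_k - z_c l_c)` over the logarithmic weights
`l`, where `z` is any positive state carrying the offered load: the stationarity conditions in the
directions of the multipliers are exactly the constraints. -/
theorem Feasible.exists_productForm (hP : P.Feasible) :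
    ∃ (xs : P.State) (q : (σ → ℝ) × (ι → ℝ)),
      (∀ c, State.full xs c = Real.exp (P.multiplierMap q c) / c.weight) ∧
      ∀ i, State.load xs i = P.rho i := by
  classical
  obtain ⟨z, hz, hzload⟩ := hP.exists_pos
  set f : (P.Conf → ℝ) → ℝ := fun l =>
    ∑ c, (Real.exp (l c) / c.weight - State.full z c * l c) with hf
  have hfc : Continuous f := by
    refine continuous_finsetSum _ fun c _ => ?_
    exact ((Real.continuous_exp.comp (continuous_apply c)).div_const _).sub
      ((continuous_apply c).const_mul _)
  obtain ⟨δ, hδ, hδle⟩ : ∃ δ : ℝ, 0 < δ ∧ ∀ c : P.Conf, δ ≤ State.full z c := by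
    have h : ∀ᶠ δ : ℝ in 𝓝[>] 0, ∀ c : P.Conf, δ ≤ State.full z c := eventually_all.2 fun c =>
      (eventually_le_nhds (hz c)).filter_mono nhdsWithin_le_nhds
    obtain ⟨δ, h, hδ⟩ := (h.and self_mem_nhdsWithin).exists
    exact ⟨δ, hδ, h⟩
  choose C hC using fun c : P.Conf => exists_forall_mul_abs_sub_le c.weight_pos (hz c)
  -- coercivity, for which all coordinates of `z` have to be positive
  have hcoer : ∀ l, δ * ‖l‖ - ∑ c, C c ≤ f l := fun l => by
    have h1 : ‖l‖ ≤ ∑ c, |l c| := (pi_norm_le_iff_of_nonneg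
      (Finset.sum_nonneg fun c _ => abs_nonneg _)).2 fun c =>
        Finset.single_le_sum (f := fun c => |l c|) (fun c _ => abs_nonneg _) (Finset.mem_univ c)
    calc δ * ‖l‖ - ∑ c, C c ≤ δ * ∑ c, |l c| - ∑ c, C c := by gcongr
      _ = ∑ c, (δ * |l c| - C c) := by rw [Finset.mul_sum, Finset.sum_sub_distrib]
      _ ≤ f l := Finset.sum_le_sum fun c _ => le_trans
          (sub_le_sub_right (mul_le_mul_of_nonneg_right (hδle c) (abs_nonneg _)) _) (hC c (l c))
  have htend : Tendsto f (cocompact _) atTop := by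
    refine tendsto_atTop_mono hcoer ?_
    exact tendsto_atTop_add_const_right _ _
      ((tendsto_norm_cocompact_atTop (E := P.Conf → ℝ)).const_mul_atTop hδ)
  obtain ⟨l, hl, hmin⟩ := hfc.continuousOn.exists_isMinOn'
    (Submodule.closed_of_finiteDimensional (LinearMap.range P.multiplierMap))
    (Submodule.zero_mem _)
    ((htend.eventually (eventually_ge_atTop (f 0))).filter_mono inf_le_left)
  obtain ⟨q, rfl⟩ := hl
  set p : P.Conf → ℝ := fun c => Real.exp (P.multiplierMap q c) / c.weight with hp
  have hstat : ∀ q', ∑ c, p c * P.multiplierMap q' c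
      = ∑ c, State.full z c * P.multiplierMap q' c := fun q' => by
    have hd : HasDerivAt (fun t : ℝ => f (P.multiplierMap q + t • P.multiplierMap q'))
        (∑ c, (p c * P.multiplierMap q' c - State.full z c * P.multiplierMap q' c)) 0 := by
      refine HasDerivAt.fun_sum fun c _ => ?_
      have h1 : HasDerivAt (fun t : ℝ => (P.multiplierMap q + t • P.multiplierMap q') c)
          (P.multiplierMap q' c) 0 := by
        simpa using ((hasDerivAt_id (0 : ℝ)).mul_const (P.multiplierMap q' c)).const_add
          (P.multiplierMap q c)
      have h2 := (h1.exp.div_const c.weight).fun_sub (h1.const_mul (State.full z c))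
      convert h2 using 1
      simp only [zero_smul, add_zero, hp]
      ring
    have hloc : IsLocalMin (fun t : ℝ => f (P.multiplierMap q + t • P.multiplierMap q')) 0 :=
      Filter.Eventually.of_forall fun t => by
        beta_reduce
        rw [zero_smul, add_zero]
        exact hmin (Submodule.add_mem _ (LinearMap.mem_range_self _ _)
          (Submodule.smul_mem _ _ (LinearMap.mem_range_self _ _)))
    have h0 := hloc.hasDerivAt_eq_zero hd
    rw [Finset.sum_sub_distrib] at h0
    linarith
  have hserver : ∀ s, ∑ c with Conf.server c = s, p c = P.h s := fun s => by
    have := hstat (Pi.single s 1, 0)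
    rw [sum_mul_multiplierMap, sum_mul_multiplierMap] at this
    simpa [Pi.single_apply, State.sum_full_server] using this
  have hload : ∀ i, ∑ c : P.Conf, (c.num i : ℝ) * p c = P.rho i := fun i => by
    have := hstat (0, Pi.single i 1)
    rw [sum_mul_multiplierMap, sum_mul_multiplierMap] at this
    rw [← hzload i]
    simpa [Pi.single_apply, State.load] using this
  refine ⟨P.ofFull p, q, fun c => by rw [full_ofFull hserver], fun i => ?_⟩
  rw [State.load, full_ofFull hserver]
  exact hload i

/-- The relative entropy of the fluid state `x` with respect to `xs`. -/
def relEntropy (xs x : P.State) : ℝ :=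
  ∑ c, State.full xs c * InformationTheory.klFun (State.full x c / State.full xs c)

theorem continuous_relEntropy (xs : P.State) : Continuous (relEntropy xs) :=
  continuous_finsetSum _ fun c _ => (InformationTheory.continuous_klFun.comp
    ((State.continuous_full c).div_const _)).const_mul _

theorem relEntropy_self {xs : P.State} (hxs : ∀ c, 0 < State.full xs c) :
    relEntropy xs xs = 0 :=
  Finset.sum_eq_zero fun c _ => by
    rw [div_self (hxs c).ne', InformationTheory.klFun_one, mul_zero]

theorem relEntropy_pos {xs x : P.State} (hxs : ∀ c, 0 < State.full xs c) (hx : x ∈ P.box)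
    (hne : x ≠ xs) : 0 < relEntropy xs x := by
  have h0 : ∀ c, 0 ≤ State.full x c / State.full xs c := fun c =>
    div_nonneg (mem_box_iff.1 hx c) (hxs c).le
  have hnn : ∀ c ∈ Finset.univ, 0 ≤ State.full xs c *
      InformationTheory.klFun (State.full x c / State.full xs c) := fun c _ =>
    mul_nonneg (hxs c).le (InformationTheory.klFun_nonneg (h0 c))
  refine lt_of_le_of_ne (Finset.sum_nonneg hnn) fun h => hne (State.full_injective ?_)
  ext c
  have := (Finset.sum_eq_zero_iff_of_nonneg hnn).1 h.symm c (Finset.mem_univ c)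
  have h1 := (InformationTheory.klFun_eq_zero_iff (h0 c)).1
    ((mul_eq_zero.1 this).resolve_left (hxs c).ne')
  rwa [div_eq_one_iff_eq (hxs c).ne'] at h1

/-- Up to the relative entropy, the objective is affine in the server and load constraints. -/
theorem L_eq_relEntropy {xs x : P.State} {q : (σ → ℝ) × (ι → ℝ)}
    (hxs : ∀ c, State.full xs c = Real.exp (P.multiplierMap q c) / c.weight) (hx : x ∈ P.box) :
    P.L x = relEntropy xs x - ∑ c, State.full xs c
      + (∑ s, q.1 s * P.h s + ∑ i, q.2 i * State.load x i) := by
  classical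
  have h1 := sum_mul_multiplierMap (State.full x) q
  simp_rw [State.sum_full_server] at h1
  simp_rw [State.load]
  rw [← h1, relEntropy, L, ← Finset.sum_sub_distrib, ← Finset.sum_add_distrib]
  refine Finset.sum_congr rfl fun c _ => ?_
  change State.full x c * Real.log (State.full x c * c.weight / Real.exp 1) = _
  have hw := c.weight_pos
  have hp : 0 < State.full xs c := hxs c ▸ by positivity
  rcases (mem_box_iff.1 hx c).eq_or_lt with h0 | h0
  · simp [← h0, InformationTheory.klFun_zero]
  · have hl : Real.log c.weight = P.multiplierMap q c - Real.log (State.full xs c) := by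
      rw [hxs c, Real.log_div (Real.exp_ne_zero _) hw.ne', Real.log_exp]
      ring
    rw [InformationTheory.klFun_apply, Real.log_div h0.ne' hp.ne',
      Real.log_div (mul_pos h0 hw).ne' (Real.exp_ne_zero _), Real.log_mul h0.ne' hw.ne',
      Real.log_exp, hl]
    field_simp
    ring

theorem isOptimal_unique_of_productForm {xs : P.State} {q : (σ → ℝ) × (ι → ℝ)}
    (hxs : ∀ c, State.full xs c = Real.exp (P.multiplierMap q c) / c.weight)
    (hload : ∀ i, State.load xs i = P.rho i) :
    P.IsOptimal xs ∧ ∀ y, P.IsOptimal y → y = xs := by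
  have hpos : ∀ c, 0 < State.full xs c := fun c => by
    rw [hxs c]
    exact div_pos (Real.exp_pos _) c.weight_pos
  have hmem : xs ∈ P.diamond := mem_diamond_iff.2 ⟨mem_box_iff.2 fun c => (hpos c).le, hload⟩
  have hlt : ∀ y ∈ P.diamond, y ≠ xs → P.L xs < P.L y := fun y hy hne => by
    have hy' := mem_diamond_iff.1 hy
    rw [L_eq_relEntropy hxs hy'.1, L_eq_relEntropy hxs hmem.1, relEntropy_self hpos]
    simp_rw [hload, hy'.2]
    linarith [relEntropy_pos hpos hy'.1 hne]
  refine ⟨⟨hmem, fun y hy => ?_⟩, fun y hy => ?_⟩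
  · by_cases h : y = xs
    · rw [h]
    · exact (hlt y hy h).le
  · by_contra h
    exact absurd (hy.2 xs hmem) (not_le.2 (hlt y hy.1 h))

/-! ### Fluid limits of trajectories -/

theorem IsPointSeq.le_iff_lt_count {T : ℕ → ℝ} (hT : IsPointSeq T) (m : ℕ) (y : ℝ) :
    T m ≤ y ↔ m < count T y := by
  classical
  have hex : ∃ N, y < T N := (hT.tendsto.eventually_gt_atTop y).exists
  have hiff : ∀ m, T m ≤ y ↔ m < Nat.find hex := fun m => by
    rw [Nat.lt_find_iff]
    exact ⟨fun h k hk => not_lt.2 ((hT.strictMono.monotone hk).trans h),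
      fun h => not_lt.1 (h m le_rfl)⟩
  have : {m : ℕ | T m ≤ y} = ↑(Finset.range (Nat.find hex)) := by
    ext m
    simp only [Set.mem_ofPred_eq, hiff, Finset.coe_range, Set.mem_Iio]
  rw [hiff, count, this, Set.ncard_coe_finset, Finset.card_range]

theorem tendsto_apply_of_tendstoUniformlyOn {α : Type*} {F : ℕ → α → ℝ} {f : α → ℝ} {s : Set α}
    (hF : TendstoUniformlyOn F f atTop s) {g : ℕ → α} (hg : ∀ᶠ n in atTop, g n ∈ s) {b : ℝ}
    (hb : Tendsto (fun n => f (g n)) atTop (𝓝 b)) :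
    Tendsto (fun n => F n (g n)) atTop (𝓝 b) := by
  refine hb.congr_dist ?_
  rw [Metric.tendsto_nhds]
  intro ε hε
  filter_upwards [Metric.tendstoUniformlyOn_iff.1 hF ε hε, hg] with n h1 h2
  rw [Real.dist_0_eq_abs, abs_of_nonneg dist_nonneg]
  exact h1 _ h2

theorem TendstoUOC.tendsto_apply {F : ℕ → ℝ → ℝ} {f : ℝ → ℝ} (hF : TendstoUOC F f) {y : ℕ → ℝ}
    {b : ℝ} (hy : ∀ n, 0 ≤ y n) (hlim : Tendsto y atTop (𝓝 b)) (hf : Continuous f) :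
    Tendsto (fun n => F n (y n)) atTop (𝓝 (f b)) := by
  refine tendsto_apply_of_tendstoUniformlyOn (hF (b + 1)) ?_ ((hf.tendsto b).comp hlim)
  filter_upwards [hlim.eventually_le_const (lt_add_one b)] with n hn using ⟨hy n, hn⟩

theorem TendstoUOC.tendsto_at {E : Type*} [UniformSpace E] {F : ℕ → ℝ → E} {f : ℝ → E}
    (hF : TendstoUOC F f) {t : ℝ} (ht : 0 ≤ t) : Tendsto (fun n => F n t) atTop (𝓝 (f t)) :=
  (hF t).tendsto_at ⟨ht, le_rfl⟩

theorem TendstoUOC.comp_strictMono {E : Type*} [PseudoMetricSpace E] {F : ℕ → ℝ → E} {f : ℝ → E}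
    (hF : TendstoUOC F f) {φ : ℕ → ℕ} (hφ : StrictMono φ) :
    TendstoUOC (fun n => F (φ n)) f := fun T =>
  Metric.tendstoUniformlyOn_iff.2 fun ε hε =>
    hφ.tendsto_atTop.eventually (Metric.tendstoUniformlyOn_iff.1 (hF T) ε hε)

theorem SatisfiesFSLLN.comp_strictMono {ω : P.Driving} {r : ℕ → ℝ} (h : P.SatisfiesFSLLN ω r)
    {φ : ℕ → ℕ} (hφ : StrictMono φ) : P.SatisfiesFSLLN ω (fun n => r (φ n)) where
  dep e := (h.dep e).comp_strictMono hφ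
  arr i := (h.arr i).comp_strictMono hφ
  xi i T := Metric.tendstoUniformlyOn_iff.2 fun ε hε =>
    hφ.tendsto_atTop.eventually (Metric.tendstoUniformlyOn_iff.1 (h.xi i T) ε hε)

/-- `(x, d, a)` is the fluid limit of trajectories `(X n, D n, A n)` of systems with scaling
parameters `r n`; unlike in `IsFluidSamplePath`, the subsequence has already been extracted. -/
structure IsFluidLimit (x : ℝ → P.State) (d a : ℝ → P.Edge → ℝ) (ω : P.Driving)
    (index : ι → P.Conf → ℕ) (r : ℕ → ℝ) (H : ℕ → σ → ℕ) (X : ℕ → ℝ → P.Conf → ℕ)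
    (D A : ℕ → ℝ → P.Edge → ℕ) : Prop where
  continuousOn : ContinuousOn x (Set.Ici 0)
  r_pos : ∀ n, 0 < r n
  H_tendsto : ∀ s, Tendsto (fun n => (H n s : ℝ) / r n) atTop (𝓝 (P.h s))
  index_inj : ∀ i, Set.InjOn (index i) (P.fits i : Set P.Conf)
  fslln : P.SatisfiesFSLLN ω r
  traj : ∀ n, P.IsTrajectory ω index (r n) (H n) (X n) (D n) (A n)
  x_lim : TendstoUOC (fun n t => WithLp.toLp 2 (fun k : P.NZConf => (X n t k.1 : ℝ) / r n)) x
  d_lim : TendstoUOC (fun n t e => (D n t e : ℝ) / r n) d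
  a_lim : TendstoUOC (fun n t e => (A n t e : ℝ) / r n) a

theorem IsFluidSamplePath.exists_isFluidLimit {Q : P.SystemSequence} {x : ℝ → P.State}
    {d a : ℝ → P.Edge → ℝ} (h : P.IsFluidSamplePath Q x d a) :
    ∃ ω index r H X D A, IsFluidLimit x d a ω index r H X D A := by
  obtain ⟨hx, -, -, ω, hω, φ, hφ, X, D, A, htraj, hX, hD, hA⟩ := h
  exact ⟨ω, Q.index, fun n => Q.r (φ n), fun n => Q.H (φ n), X, D, A, hx.continuousOn,
    fun n => one_pos.trans_le (Q.one_le_r _),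
    fun s => (Q.H_tendsto s).comp hφ.tendsto_atTop, Q.index_inj, hω.comp_strictMono hφ, htraj,
    hX, hD, hA⟩

theorem State.uniformContinuous_full (c : P.Conf) :
    UniformContinuous fun x : P.State => State.full x c := by
  classical
  by_cases hc : c.num = 0
  · simp_rw [State.full_of_num_eq_zero _ hc, State.zero]
    have := (∑ k ∈ Finset.univ.filter (fun k : P.NZConf => k.1.server = c.server),
      (EuclideanSpace.proj k : P.State →L[ℝ] ℝ)).uniformContinuous
    have h := (uniformContinuous_const (b := P.h c.server)).sub this
    convert h using 2 with x
    simp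
  · simp_rw [fun x : P.State => State.full_nz x ⟨c, hc⟩]
    exact (EuclideanSpace.proj (⟨c, hc⟩ : P.NZConf) : P.State →L[ℝ] ℝ).uniformContinuous

theorem integrableOn_of_forall_eq {f : ℝ → ℝ} {v : ℝ} {s : Set ℝ} (hs : MeasurableSet s)
    (hfin : MeasureTheory.volume s ≠ ⊤) (h : ∀ u ∈ s, f u = v) : MeasureTheory.IntegrableOn f s :=
  (MeasureTheory.integrableOn_congr_fun h hs).2 (MeasureTheory.integrableOn_const hfin)

theorem integrableAtFilter_nhdsGE {f : ℝ → ℝ} {t v : ℝ} (h : ∀ᶠ u in 𝓝[≥] t, f u = v) :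
    MeasureTheory.IntegrableAtFilter f (𝓝[≥] t) := by
  obtain ⟨y, hy, hsub⟩ := mem_nhdsGE_iff_exists_Ico_subset.1 h
  exact ⟨Set.Ico t y, Ico_mem_nhdsGE hy,
    integrableOn_of_forall_eq measurableSet_Ico (by simp) fun u hu => hsub hu⟩

theorem integrableAtFilter_nhdsLT {f : ℝ → ℝ} {t v : ℝ} (h : ∀ᶠ u in 𝓝[<] t, f u = v) :
    MeasureTheory.IntegrableAtFilter f (𝓝[<] t) := by
  obtain ⟨y, hy, hsub⟩ := mem_nhdsLT_iff_exists_Ioo_subset.1 h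
  exact ⟨Set.Ioo y t, Ioo_mem_nhdsLT hy,
    integrableOn_of_forall_eq measurableSet_Ioo (by simp) fun u hu => hsub hu⟩

/-- The numbers of servers are integrable, being locally constant on both sides of each time. Hence
the integral which drives the departures has its proper meaning. -/
theorem IsTrajectory.intervalIntegrable {ω : P.Driving} {index : ι → P.Conf → ℕ} {r : ℝ}
    {H : σ → ℕ} {X : ℝ → P.Conf → ℕ} {D A : ℝ → P.Edge → ℕ}
    (h : P.IsTrajectory ω index r H X D A) (c : P.Conf) {t : ℝ} (ht : 0 ≤ t) :
    IntervalIntegrable (fun u => (X u c : ℝ)) MeasureTheory.volume 0 t := by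
  rw [intervalIntegrable_iff_integrableOn_Icc_of_le ht]
  refine MeasureTheory.LocallyIntegrableOn.integrableOn_isCompact (fun u hu => ?_) isCompact_Icc
  have h1 : MeasureTheory.IntegrableAtFilter (fun u => (X u c : ℝ)) (𝓝[≥] u) := by
    refine integrableAtFilter_nhdsGE (v := (X u c : ℝ)) ?_
    rw [← Set.Ioi_insert, nhdsWithin_insert, eventually_sup]
    refine ⟨rfl, ?_⟩
    filter_upwards [h.right_cont u hu.1] with w hw
    rw [hw]
  rcases hu.1.eq_or_lt with h0 | h0
  · exact h1.filter_mono (nhdsWithin_mono _ fun w hw => h0 ▸ hw.1)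
  · obtain ⟨v, hv⟩ := h.left_lim u h0
    have h2 : MeasureTheory.IntegrableAtFilter (fun u => (X u c : ℝ)) (𝓝[<] u) := by
      refine integrableAtFilter_nhdsLT (v := (v c : ℝ)) ?_
      filter_upwards [hv] with w hw
      rw [hw]
    refine (MeasureTheory.IntegrableAtFilter.sup_iff.2 ⟨h2, h1⟩).filter_mono ?_
    rw [← nhdsWithin_union, Set.Iio_union_Ici, nhdsWithin_univ]
    exact nhdsWithin_le_nhds

section FluidLimit

variable {x : ℝ → P.State} {d a : ℝ → P.Edge → ℝ} {ω : P.Driving}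
  {index : ι → P.Conf → ℕ} {r : ℕ → ℝ} {H : ℕ → σ → ℕ} {X : ℕ → ℝ → P.Conf → ℕ}
  {D A : ℕ → ℝ → P.Edge → ℕ}

theorem IsFluidLimit.tendstoUOC_full (hF : IsFluidLimit x d a ω index r H X D A) (c : P.Conf) :
    TendstoUOC (fun n t => (X n t c : ℝ) / r n) (fun t => State.full (x t) c) := by
  classical
  intro T
  have h1 := (State.uniformContinuous_full c).comp_tendstoUniformlyOn (hF.x_lim T)
  by_cases hc : c.num = 0
  · have h2 : TendstoUniformlyOn (fun n (_ : ℝ) => (H n c.server : ℝ) / r n - P.h c.server)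
        (fun _ => 0) atTop (Set.Icc 0 T) := by
      have := (hF.H_tendsto c.server).sub_const (P.h c.server)
      rw [sub_self] at this
      exact this.tendstoUniformlyOn_const _
    refine ((h1.add h2).congr (Eventually.of_forall fun n t ht => ?_)).congr_right
      fun t _ => add_zero _
    have h3 := (hF.traj n).total t ht.1 c.server
    have h4 : ∑ c' with Conf.server c' = c.server, (X n t c' : ℝ) = H n c.server := by
      exact_mod_cast h3
    rw [sum_filter_server] at h4
    have h5 : P.emptyConf c.server = c := Conf.ext_num rfl hc.symm
    rw [h5] at h4
    simp only [Pi.add_apply, Function.comp_apply, State.full_of_num_eq_zero _ hc, State.zero]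
    rw [← h4, ← Finset.sum_div]
    ring
  · refine (h1.congr (Eventually.of_forall fun n t _ => ?_)).congr_right fun t _ => rfl
    simp only [Function.comp_apply]
    rw [State.full_nz _ ⟨c, hc⟩]

theorem IsFluidLimit.mem_box (hF : IsFluidLimit x d a ω index r H X D A) {t : ℝ} (ht : 0 ≤ t) :
    x t ∈ P.box :=
  mem_box_iff.2 fun c => ge_of_tendsto' ((hF.tendstoUOC_full c).tendsto_at ht) fun n =>
    div_nonneg (Nat.cast_nonneg _) (hF.r_pos n).le

theorem IsFluidLimit.continuousOn_full (hF : IsFluidLimit x d a ω index r H X D A) (c : P.Conf) :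
    ContinuousOn (fun t => State.full (x t) c) (Set.Ici 0) :=
  (State.continuous_full c).comp_continuousOn hF.continuousOn

/-- During a short period after `t` the scaled states of all but finitely many of the systems stay
close to the fluid state at the time `t`. -/
theorem IsFluidLimit.eventually_mem (hF : IsFluidLimit x d a ω index r H X D A) {t : ℝ}
    (ht : 0 ≤ t) {U : Set (P.Conf → ℝ)} (hU : U ∈ 𝓝 (State.full (x t))) :
    ∃ b : ℝ, 0 < b ∧ ∀ᶠ n in atTop, ∀ u ∈ Set.Icc t (t + b),
      (fun c => (X n u c : ℝ) / r n) ∈ U := by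
  obtain ⟨ε, hε, hball⟩ := Metric.mem_nhds_iff.1 hU
  have h1 : ∀ᶠ u in 𝓝[≥] t, ∀ c, dist (State.full (x u) c) (State.full (x t) c) < ε / 2 :=
    eventually_all.2 fun c => Metric.tendsto_nhds.1
      (((hF.continuousOn_full c) t ht).mono (Set.Ici_subset_Ici.2 ht)) (ε / 2) (half_pos hε)
  obtain ⟨y, hy, hsub⟩ := mem_nhdsGE_iff_exists_Ico_subset.1 h1
  have hy' : t < y := hy
  refine ⟨(y - t) / 2, by linarith, ?_⟩
  have h2 : ∀ᶠ n in atTop, ∀ c : P.Conf, ∀ u ∈ Set.Icc 0 y,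
      dist (State.full (x u) c) ((X n u c : ℝ) / r n) < ε / 2 :=
    eventually_all.2 fun c =>
      Metric.tendstoUniformlyOn_iff.1 (hF.tendstoUOC_full c y) (ε / 2) (half_pos hε)
  filter_upwards [h2] with n hn u hu
  refine hball ((dist_pi_lt_iff hε).2 fun c => ?_)
  have h3 := hn c u ⟨ht.trans hu.1, by linarith [hu.2]⟩
  have h4 := hsub ⟨hu.1, by linarith [hu.2]⟩ c
  rw [dist_comm] at h3
  calc dist ((X n u c : ℝ) / r n) (State.full (x t) c)
      ≤ dist ((X n u c : ℝ) / r n) (State.full (x u) c)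
        + dist (State.full (x u) c) (State.full (x t) c) := dist_triangle _ _ _
    _ < ε := by linarith

theorem IsFluidLimit.departures_eq_integral (hF : IsFluidLimit x d a ω index r H X D A) {t : ℝ}
    (ht : 0 ≤ t) (e : P.Edge) :
    d t e = ∫ u in (0 : ℝ)..t,
      State.full (x u) e.upper * (e.upper.num e.type : ℝ) * P.mu e.type := by
  have hint : ∀ n, IntervalIntegrable (fun u => (X n u e.upper : ℝ) / r n)
      MeasureTheory.volume 0 t := fun n => ((hF.traj n).intervalIntegrable e.upper ht).div_const _
  have hint' : IntervalIntegrable (fun u => State.full (x u) e.upper) MeasureTheory.volume 0 t :=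
    ((hF.continuousOn_full e.upper).mono (by
      rw [Set.uIcc_of_le ht]
      exact Set.Icc_subset_Ici_self)).intervalIntegrable
  have hlim : Tendsto (fun n => ∫ u in (0 : ℝ)..t, (X n u e.upper : ℝ) / r n) atTop
      (𝓝 (∫ u in (0 : ℝ)..t, State.full (x u) e.upper)) := by
    rw [Metric.tendsto_nhds]
    intro ε hε
    filter_upwards [Metric.tendstoUniformlyOn_iff.1 (hF.tendstoUOC_full e.upper t) (ε / (t + 1))
      (by positivity)] with n hn
    rw [dist_eq_norm, ← intervalIntegral.integral_sub (hint n) hint']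
    refine lt_of_le_of_lt (intervalIntegral.norm_integral_le_of_norm_le_const
      (C := ε / (t + 1)) fun u hu => ?_) ?_
    · rw [Set.uIoc_of_le ht] at hu
      rw [← dist_eq_norm, dist_comm]
      exact (hn u ⟨hu.1.le, hu.2⟩).le
    · rw [sub_zero, abs_of_nonneg ht, div_mul_eq_mul_div, div_lt_iff₀ (by linarith)]
      nlinarith
  set κ : ℝ := (e.upper.num e.type : ℝ) * P.mu e.type with hκ
  have hκ0 : 0 ≤ κ := mul_nonneg (Nat.cast_nonneg _) (P.mu_pos _).le
  have h1 := (hF.fslln.dep e).tendsto_apply (y := fun n =>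
    (∫ u in (0 : ℝ)..t, (X n u e.upper : ℝ) / r n) * κ) (fun n => mul_nonneg
      (intervalIntegral.integral_nonneg ht fun u _ =>
        div_nonneg (Nat.cast_nonneg _) (hF.r_pos n).le) hκ0) (hlim.mul_const κ) continuous_id
  have h2 : Tendsto (fun n => (D n t e : ℝ) / r n) atTop (𝓝 (d t e)) :=
    ((continuous_apply e).tendsto _).comp (hF.d_lim.tendsto_at ht)
  refine (tendsto_nhds_unique h2 (h1.congr fun n => ?_)).trans ?_
  · rw [(hF.traj n).departures t ht e]
    congr 3
    rw [intervalIntegral.integral_div]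
    simp_rw [mul_assoc, ← hκ]
    rw [intervalIntegral.integral_mul_const]
    have := (hF.r_pos n).ne'
    field_simp
  · simp_rw [mul_assoc, ← hκ]
    rw [intervalIntegral.integral_mul_const]

theorem IsFluidLimit.hasDerivWithinAt_departures (hF : IsFluidLimit x d a ω index r H X D A)
    {t : ℝ} (ht : 0 ≤ t) (e : P.Edge) :
    HasDerivWithinAt (fun s => d s e)
      (State.full (x t) e.upper * (e.upper.num e.type : ℝ) * P.mu e.type) (Set.Ici t) t := by
  have hc : ContinuousOn (fun u => State.full (x u) e.upper * (e.upper.num e.type : ℝ)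
      * P.mu e.type) (Set.Ici 0) :=
    ((hF.continuousOn_full e.upper).mul_const _).mul_const _
  have h1 := intervalIntegral.integral_hasDerivWithinAt_right (a := 0) (b := t)
    (s := Set.Ici t) (t := Set.Ioi t)
    (hc.mono (by rw [Set.uIcc_of_le ht]; exact Set.Icc_subset_Ici_self)).intervalIntegrable
    ((hc.mono (Set.Ioi_subset_Ici ht)).stronglyMeasurableAtFilter_nhdsWithin measurableSet_Ioi t)
    ((hc t ht).mono (Set.Ioi_subset_Ici ht))
  exact h1.congr (fun s hs => hF.departures_eq_integral (ht.trans hs) e)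
    (hF.departures_eq_integral ht e)

/-! ### Arrivals in the fluid limit -/

/-- The proportion of the first placement variables that are at most `z` tends to the distribution
function of the uniform distribution at `z`. -/
theorem SatisfiesFSLLN.tendsto_placements (h : P.SatisfiesFSLLN ω r) (hr : ∀ n, 0 < r n) (i : ι)
    (z : ℝ) {N : ℕ → ℕ} {τ : ℝ} (hN : Tendsto (fun n => (N n : ℝ) / r n) atTop (𝓝 τ)) :
    Tendsto (fun n => (∑ m ∈ Finset.range (N n), if ω.xi i m ≤ z then (1 : ℝ) else 0) / r n) atTop
      (𝓝 (τ * max 0 (min 1 z))) := by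
  classical
  have h1 := tendsto_apply_of_tendstoUniformlyOn (h.xi i (τ + 1))
    (g := fun n => ((N n : ℝ) / r n, max 0 (min 1 z))) (b := τ * max 0 (min 1 z)) (by
      filter_upwards [hN.eventually_le_const (lt_add_one τ)] with n hn
      exact ⟨⟨div_nonneg (Nat.cast_nonneg _) (hr n).le, hn⟩, le_max_left _ _,
        max_le zero_le_one (min_le_left _ _)⟩) (hN.mul_const _)
  refine h1.congr fun n => ?_
  congr 1
  -- the floor is exact, as `r n` times the scaled number is the natural number `N n`
  rw [mul_div_cancel₀ _ (hr n).ne', Nat.floor_natCast, Finset.natCast_card_filter]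
  refine Finset.sum_congr rfl fun m _ => ?_
  have hm := ω.xi_mem i m
  have : ω.xi i m ≤ max 0 (min 1 z) ↔ ω.xi i m ≤ z := by
    rw [le_max_iff, le_min_iff]
    exact ⟨fun h => (h.resolve_left (not_le.2 hm.1)).2, fun h => Or.inr ⟨hm.2, h⟩⟩
  simp only [this]

/-- The sum of a function on the configurations that fit a customer of type `i` and whose index
satisfies `q`. -/
def partialSum (P : PackingModel ι σ) (index : P.Conf → ℕ) (i : ι) (q : ℕ → Prop)
    [DecidablePred q] (v : P.Conf → ℝ) : ℝ :=
  ∑ c ∈ (P.fits i).filter (fun c => q (index c)), v c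

theorem continuous_partialSum (index : P.Conf → ℕ) (i : ι) (q : ℕ → Prop) [DecidablePred q] :
    Continuous (partialSum P index i q) :=
  continuous_finsetSum _ fun _ _ => continuous_apply _

theorem partialSum_mono {index : P.Conf → ℕ} {i : ι} {q q' : ℕ → Prop} [DecidablePred q]
    [DecidablePred q'] (hq : ∀ m, q m → q' m) {v : P.Conf → ℝ} (hv : ∀ c, 0 ≤ v c) :
    partialSum P index i q v ≤ partialSum P index i q' v :=
  Finset.sum_le_sum_of_subset_of_nonneg
    (Finset.monotone_filter_right _ fun _ _ hc => hq _ hc) fun c _ _ => hv c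

theorem partialSum_nonneg {index : P.Conf → ℕ} {i : ι} {q : ℕ → Prop} [DecidablePred q]
    {v : P.Conf → ℝ} (hv : ∀ c, 0 ≤ v c) : 0 ≤ partialSum P index i q v :=
  Finset.sum_nonneg fun c _ => hv c

theorem partialSum_true (index : P.Conf → ℕ) (i : ι) (v : P.Conf → ℝ) :
    partialSum P index i (fun _ => True) v = ∑ c ∈ P.fits i, v c := by
  rw [partialSum, Finset.filter_true_of_mem fun _ _ => trivial]

theorem partialSum_le_eq_add {index : P.Conf → ℕ} {i : ι}
    (hinj : Set.InjOn index (P.fits i : Set P.Conf)) {c : P.Conf} (hc : c ∈ P.fits i)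
    (v : P.Conf → ℝ) :
    partialSum P index i (· ≤ index c) v = partialSum P index i (· < index c) v + v c := by
  classical
  have : (P.fits i).filter (fun c' => index c' ≤ index c)
      = insert c ((P.fits i).filter fun c' => index c' < index c) := by
    ext c'
    simp only [Finset.mem_filter, Finset.mem_insert]
    constructor
    · rintro ⟨h1, h2⟩
      rcases h2.lt_or_eq with h | h
      · exact Or.inr ⟨h1, h⟩
      · exact Or.inl (hinj h1 hc h)
    · rintro (rfl | ⟨h1, h2⟩)
      · exact ⟨hc, le_rfl⟩
      · exact ⟨h1, h2.le⟩
  rw [partialSum, this, Finset.sum_insert (by simp), add_comm]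
  rfl

theorem assigned_iff {index : P.Conf → ℕ} {X : P.Conf → ℕ} {i : ι} {z ρ : ℝ} (hρ : 0 < ρ)
    {c : P.Conf} (hc : c ∈ P.fits i) :
    P.Assigned index X i z c ↔
      partialSum P index i (· < index c) (fun c => (X c : ℝ) / ρ)
        < z * partialSum P index i (fun _ => True) (fun c => (X c : ℝ) / ρ) ∧
      z * partialSum P index i (fun _ => True) (fun c => (X c : ℝ) / ρ)
        ≤ partialSum P index i (· ≤ index c) (fun c => (X c : ℝ) / ρ) := by
  rw [partialSum_true]
  simp only [Assigned, partialSum, ← Finset.sum_div, mul_div_assoc', hc, true_and]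
  rw [div_lt_div_iff_of_pos_right hρ, div_le_div_iff_of_pos_right hρ]
  push_cast
  congr!

theorem hasDerivWithinAt_Ici_of_forall {f : ℝ → ℝ} {f' t : ℝ}
    (h : ∀ δ : ℝ, 0 < δ → ∃ b : ℝ, 0 < b ∧ ∀ s ∈ Set.Ioc t (t + b),
      |f s - f t - f' * (s - t)| ≤ δ * (s - t)) :
    HasDerivWithinAt f f' (Set.Ici t) t := by
  rw [hasDerivWithinAt_iff_isLittleO, Asymptotics.isLittleO_iff]
  intro δ hδ
  obtain ⟨b, hb, hle⟩ := h δ hδ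
  filter_upwards [Icc_mem_nhdsGE (show t < t + b by linarith)] with s hs
  rw [smul_eq_mul, mul_comm (s - t), Real.norm_eq_abs, Real.norm_eq_abs,
    abs_of_nonneg (sub_nonneg.2 hs.1)]
  rcases hs.1.eq_or_lt with rfl | h0
  · simp
  · exact hle s ⟨h0, hs.2⟩

theorem IsTrajectory.arrivals_eq_sum {r : ℝ} {H : σ → ℕ} {X : ℝ → P.Conf → ℕ}
    {D A : ℝ → P.Edge → ℕ} (h : P.IsTrajectory ω index r H X D A) (hr : 0 < r) {t : ℝ}
    (ht : 0 ≤ t) (e : P.Edge) [DecidablePred fun m => ∀ᶠ u in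
      𝓝[<] (ω.arr e.type m / (P.lam e.type * r)),
        P.Assigned (index e.type) (X u) e.type (ω.xi e.type m) e.lower] :
    (A t e : ℝ) = ∑ m ∈ Finset.range (count (ω.arr e.type) (r * (P.lam e.type * t))),
      if ∀ᶠ u in 𝓝[<] (ω.arr e.type m / (P.lam e.type * r)),
        P.Assigned (index e.type) (X u) e.type (ω.xi e.type m) e.lower then 1 else 0 := by
  rw [h.arrivals t ht e, ← Finset.natCast_card_filter, ← Set.ncard_coe_finset]
  congr 2
  ext m
  have hlr : 0 < P.lam e.type * r := mul_pos (P.lam_pos _) hr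
  simp only [Set.mem_ofPred_eq, Finset.coe_filter, Finset.mem_range,
    ← (ω.arr_seq e.type).le_iff_lt_count]
  rw [div_le_iff₀ hlr, show t * (P.lam e.type * r) = r * (P.lam e.type * t) by ring]

/-- While some servers can take customers of type `i`, the fluid arrival rate along an edge
`(k, i)` is `λ_i x_{k - e_i} / x_(i)`. The placement interval of `k - e_i` hardly changes during a
short period, so that the number of arrivals is squeezed between the numbers of placement variables
in a slightly smaller and a slightly larger fixed interval. -/
theorem IsFluidLimit.hasDerivWithinAt_arrivals (hF : IsFluidLimit x d a ω index r H X D A)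
    {t : ℝ} (ht : 0 ≤ t) (e : P.Edge) (hpos : 0 < ∑ c ∈ P.fits e.type, State.full (x t) c) :
    HasDerivWithinAt (fun s => a s e)
      (P.lam e.type * (State.full (x t) e.lower / ∑ c ∈ P.fits e.type, State.full (x t) c))
      (Set.Ici t) t := by
  classical
  have hbox := mem_box_iff.1 (hF.mem_box ht)
  set i := e.type with hi
  set lo := partialSum P (index i) i (· < index i e.lower) with hlo
  set hi' := partialSum P (index i) i (· ≤ index i e.lower) with hhi
  set tot := partialSum P (index i) i (fun _ => True) with htot
  set v := State.full (x t) with hv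
  have htotv : tot v = ∑ c ∈ P.fits i, v c := partialSum_true _ _ _
  rw [← htotv] at hpos ⊢
  have hsplit : hi' v = lo v + v e.lower :=
    partialSum_le_eq_add (hF.index_inj i) e.lower_mem_fits v
  -- `(α, β]` is the placement interval of `k - e_i` in the fluid state at the time `t`
  set α := lo v / tot v with hα
  set β := hi' v / tot v with hβ
  have hαβ : β - α = v e.lower / tot v := by
    rw [hα, hβ, hsplit]
    ring
  have hα0 : 0 ≤ α := div_nonneg (partialSum_nonneg hbox) hpos.le
  have hβ1 : β ≤ 1 := (div_le_one hpos).2 (partialSum_mono (fun _ _ => trivial) hbox)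
  have hle : α ≤ β := sub_nonneg.1 (hαβ ▸ div_nonneg (hbox _) hpos.le)
  have hlam := P.lam_pos i
  rw [← hαβ]
  refine hasDerivWithinAt_Ici_of_forall fun δ' hδ' => ?_
  obtain ⟨δ, hδ, hδδ⟩ : ∃ δ : ℝ, 0 < δ ∧ P.lam i * (2 * δ) = δ' :=
    ⟨δ' / (2 * P.lam i), by positivity, by field_simp⟩
  have hU : {w : P.Conf → ℝ | 0 < tot w ∧ α - δ < lo w / tot w ∧ lo w / tot w < α + δ ∧
      β - δ < hi' w / tot w ∧ hi' w / tot w < β + δ} ∈ 𝓝 v := by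
    have h1 : Tendsto tot (𝓝 v) (𝓝 (tot v)) := (continuous_partialSum _ _ _).tendsto v
    have h2 : Tendsto (fun w => lo w / tot w) (𝓝 v) (𝓝 α) :=
      ((continuous_partialSum _ _ _).tendsto v).div h1 hpos.ne'
    have h3 : Tendsto (fun w => hi' w / tot w) (𝓝 v) (𝓝 β) :=
      ((continuous_partialSum _ _ _).tendsto v).div h1 hpos.ne'
    filter_upwards [h1.eventually_const_lt hpos,
      h2.eventually_const_lt (show α - δ < α by linarith),
      h2.eventually_lt_const (show α < α + δ by linarith),
      h3.eventually_const_lt (show β - δ < β by linarith),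
      h3.eventually_lt_const (show β < β + δ by linarith)] with w k1 k2 k3 k4 k5
    exact ⟨k1, k2, k3, k4, k5⟩
  obtain ⟨b, hb, hev⟩ := hF.eventually_mem ht hU
  refine ⟨b, hb, fun s hs => ?_⟩
  have hs0 : 0 ≤ s := ht.trans hs.1.le
  -- the number of arrivals of type `i` in `[0, t]`
  set N : ℕ → ℝ → ℕ := fun n t => count (ω.arr i) (r n * (P.lam i * t)) with hN
  have hNlim : ∀ t, 0 ≤ t → Tendsto (fun n => (N n t : ℝ) / r n) atTop (𝓝 (P.lam i * t)) :=
    fun t ht => (hF.fslln.arr i).tendsto_at (mul_nonneg hlam.le ht)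
  -- the `m`-th customer of type `i` is placed along the edge `e`
  set Q : ℕ → ℕ → Prop := fun n m => ∀ᶠ u in 𝓝[<] (ω.arr i m / (P.lam i * r n)),
    P.Assigned (index i) (X n u) i (ω.xi i m) e.lower with hQ
  -- the scaled number of arrivals in `(t, s]` whose placement variable is at most `z`
  set S : ℕ → ℝ → ℝ := fun n z =>
    ((∑ m ∈ Finset.range (N n s), if ω.xi i m ≤ z then (1 : ℝ) else 0) / r n
      - (∑ m ∈ Finset.range (N n t), if ω.xi i m ≤ z then (1 : ℝ) else 0) / r n) with hS
  have hSlim : ∀ z, Tendsto (fun n => S n z) atTop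
      (𝓝 (P.lam i * (s - t) * max 0 (min 1 z))) := fun z => by
    have := (hF.fslln.tendsto_placements hF.r_pos i z (hNlim s hs0)).sub
      (hF.fslln.tendsto_placements hF.r_pos i z (hNlim t ht))
    convert this using 2
    ring
  have hNmono : ∀ n, N n t ≤ N n s := fun n => by
    by_contra! hlt
    have h1 := ((ω.arr_seq i).le_iff_lt_count (N n s) (r n * (P.lam i * t))).2 hlt
    refine lt_irrefl (N n s) (((ω.arr_seq i).le_iff_lt_count _ _).1 (h1.trans ?_))
    have := hF.r_pos n
    have := hs.1.le
    gcongr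
  have hSIco : ∀ n z, S n z
      = (∑ m ∈ Finset.Ico (N n t) (N n s), if ω.xi i m ≤ z then (1 : ℝ) else 0) / r n :=
    fun n z => by rw [Finset.sum_Ico_eq_sub _ (hNmono n), sub_div]
  have hAIco : ∀ n, (A n s e : ℝ) / r n - (A n t e : ℝ) / r n
      = (∑ m ∈ Finset.Ico (N n t) (N n s), if Q n m then (1 : ℝ) else 0) / r n := fun n => by
    rw [Finset.sum_Ico_eq_sub _ (hNmono n), sub_div,
      (hF.traj n).arrivals_eq_sum (hF.r_pos n) hs0 e,
      (hF.traj n).arrivals_eq_sum (hF.r_pos n) ht e]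
  have htime : ∀ n, ∀ m ∈ Finset.Ico (N n t) (N n s),
      ω.arr i m / (P.lam i * r n) ∈ Set.Ioc t s := fun n m hm => by
    have hlr : 0 < P.lam i * r n := mul_pos hlam (hF.r_pos n)
    rw [Finset.mem_Ico] at hm
    constructor
    · have := mt ((ω.arr_seq i).le_iff_lt_count m (r n * (P.lam i * t))).1 (not_lt.2 hm.1)
      rw [lt_div_iff₀ hlr]
      linarith
    · have := ((ω.arr_seq i).le_iff_lt_count m (r n * (P.lam i * s))).2 hm.2
      rw [div_le_iff₀ hlr]
      linarith
  -- the placement interval at each arrival in `(t, s]` has endpoints within `δ` of `α` and `β`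
  have hclose : ∀ᶠ n in atTop, ∀ m ∈ Finset.Ico (N n t) (N n s),
      (Q n m → α - δ < ω.xi i m ∧ ω.xi i m ≤ β + δ) ∧
      (α + δ < ω.xi i m → ω.xi i m ≤ β - δ → Q n m) := by
    filter_upwards [hev] with n hn m hm
    have hτ := htime n m hm
    have hIoo := Ioo_mem_nhdsLT hτ.1
    have hmem : ∀ u ∈ Set.Ioo t (ω.arr i m / (P.lam i * r n)), u ∈ Set.Icc t (t + b) :=
      fun u hu => ⟨hu.1.le, (hu.2.le.trans hτ.2).trans hs.2⟩
    constructor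
    · intro hq
      obtain ⟨u, hu, hu'⟩ := (hq.and hIoo).exists
      obtain ⟨k1, k2, k3, k4, k5⟩ := hn u (hmem u hu')
      rw [assigned_iff (hF.r_pos n) e.lower_mem_fits] at hu
      rw [lt_div_iff₀ k1] at k2
      rw [div_lt_iff₀ k1] at k5
      exact ⟨lt_of_mul_lt_mul_right (k2.trans hu.1) k1.le,
        (lt_of_mul_lt_mul_right (hu.2.trans_lt k5) k1.le).le⟩
    · intro h1 h2
      filter_upwards [hIoo] with u hu
      obtain ⟨k1, k2, k3, k4, k5⟩ := hn u (hmem u hu)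
      rw [assigned_iff (hF.r_pos n) e.lower_mem_fits]
      rw [div_lt_iff₀ k1] at k3
      rw [lt_div_iff₀ k1] at k4
      exact ⟨k3.trans (mul_lt_mul_of_pos_right h1 k1),
        (mul_le_mul_of_nonneg_right h2 k1.le).trans k4.le⟩
  have hAlim : Tendsto (fun n => (A n s e : ℝ) / r n - (A n t e : ℝ) / r n) atTop
      (𝓝 (a s e - a t e)) :=
    (((continuous_apply e).tendsto _).comp (hF.a_lim.tendsto_at hs0)).sub
      (((continuous_apply e).tendsto _).comp (hF.a_lim.tendsto_at ht))
  have hupper : a s e - a t e ≤ P.lam i * (s - t) * max 0 (min 1 (β + δ))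
      - P.lam i * (s - t) * max 0 (min 1 (α - δ)) := by
    refine le_of_tendsto_of_tendsto hAlim ((hSlim (β + δ)).sub (hSlim (α - δ))) ?_
    filter_upwards [hclose] with n hn
    rw [hAIco, hSIco, hSIco, ← sub_div, ← Finset.sum_sub_distrib]
    refine div_le_div_of_nonneg_right (Finset.sum_le_sum fun m hm => ?_) (hF.r_pos n).le
    have := (hn m hm).1
    by_cases hq : Q n m
    · rw [if_pos hq, if_pos (this hq).2, if_neg (not_le.2 (this hq).1), sub_zero]
    · rw [if_neg hq]
      split_ifs
      · simp
      · simp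
      · linarith
      · simp
  have hlower : P.lam i * (s - t) * max 0 (min 1 (β - δ))
      - P.lam i * (s - t) * max 0 (min 1 (α + δ)) ≤ a s e - a t e := by
    refine le_of_tendsto_of_tendsto ((hSlim (β - δ)).sub (hSlim (α + δ))) hAlim ?_
    filter_upwards [hclose] with n hn
    rw [hAIco, hSIco, hSIco, ← sub_div, ← Finset.sum_sub_distrib]
    refine div_le_div_of_nonneg_right (Finset.sum_le_sum fun m hm => ?_) (hF.r_pos n).le
    have := (hn m hm).2
    by_cases hq : Q n m
    · rw [if_pos hq]
      split_ifs <;> simp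
    · rw [if_neg hq]
      split_ifs with h1 h2 h2
      · simp
      · exact absurd (this (not_le.1 h2) h1) hq
      · simp
      · simp
  have hst : 0 ≤ P.lam i * (s - t) := mul_nonneg hlam.le (sub_nonneg.2 hs.1.le)
  have e1 : max 0 (min 1 (β + δ)) ≤ β + δ := max_le (by linarith) (min_le_right _ _)
  have e2 : α - δ ≤ max 0 (min 1 (α - δ)) := le_max_of_le_right (le_min (by linarith) le_rfl)
  have e3 : max 0 (min 1 (α + δ)) ≤ α + δ := max_le (by linarith) (min_le_right _ _)
  have e4 : β - δ ≤ max 0 (min 1 (β - δ)) := le_max_of_le_right (le_min (by linarith) le_rfl)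
  have f1 := mul_le_mul_of_nonneg_left e1 hst
  have f2 := mul_le_mul_of_nonneg_left e2 hst
  have f3 := mul_le_mul_of_nonneg_left e3 hst
  have f4 := mul_le_mul_of_nonneg_left e4 hst
  rw [← hδδ, abs_le]
  constructor <;> linarith

/-! ### The fluid dynamics -/

/-- The net rate of transitions along an edge `(k, i)` in the fluid state `x`, that is the arrival
rate `λ_i x_{k - e_i} / x_(i)` minus the departure rate `k_i μ_i x_k`. -/
def flux (x : P.State) (e : P.Edge) : ℝ :=
  P.lam e.type * (State.full x e.lower / ∑ c ∈ P.fits e.type, State.full x c)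
    - State.full x e.upper * (e.upper.num e.type : ℝ) * P.mu e.type

theorem IsFluidLimit.full_eq (hF : IsFluidLimit x d a ω index r H X D A) {t : ℝ} (ht : 0 ≤ t)
    (c : P.Conf) :
    State.full (x t) c = State.full (x 0) c + netFlow (fun e => a t e - d t e) c := by
  classical
  have hA : ∀ e, Tendsto (fun n => (A n t e : ℝ) / r n - (D n t e : ℝ) / r n) atTop
      (𝓝 (a t e - d t e)) := fun e =>
    (((continuous_apply e).tendsto _).comp (hF.a_lim.tendsto_at ht)).sub
      (((continuous_apply e).tendsto _).comp (hF.d_lim.tendsto_at ht))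
  have h1 : Tendsto (fun n => (X n 0 c : ℝ) / r n
      + netFlow (fun e => (A n t e : ℝ) / r n - (D n t e : ℝ) / r n) c) atTop
      (𝓝 (State.full (x 0) c + netFlow (fun e => a t e - d t e) c)) :=
    ((hF.tendstoUOC_full c).tendsto_at le_rfl).add
      ((tendsto_finsetSum _ fun e _ => hA e).sub (tendsto_finsetSum _ fun e _ => hA e))
  refine tendsto_nhds_unique ((hF.tendstoUOC_full c).tendsto_at ht) (h1.congr fun n => ?_)
  have h2 := congrArg (fun z : ℤ => (z : ℝ)) ((hF.traj n).balance t ht c)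
  push_cast at h2
  rw [h2]
  simp only [netFlow, Finset.sum_sub_distrib, ← Finset.sum_div]
  ring

theorem IsFluidLimit.hasDerivWithinAt_full (hF : IsFluidLimit x d a ω index r H X D A) {t : ℝ}
    (ht : 0 ≤ t) (hpos : ∀ i, 0 < ∑ c ∈ P.fits i, State.full (x t) c) (c : P.Conf) :
    HasDerivWithinAt (fun s => State.full (x s) c) (netFlow (flux (x t)) c) (Set.Ici t) t := by
  classical
  have h1 : ∀ e, HasDerivWithinAt (fun s => a s e - d s e) (flux (x t) e) (Set.Ici t) t := fun e =>
    (hF.hasDerivWithinAt_arrivals ht e (hpos _)).fun_sub (hF.hasDerivWithinAt_departures ht e)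
  have h2 : HasDerivWithinAt (fun s => netFlow (fun e => a s e - d s e) c)
      (netFlow (flux (x t)) c) (Set.Ici t) t :=
    (HasDerivWithinAt.fun_sum fun e _ => h1 e).fun_sub (HasDerivWithinAt.fun_sum fun e _ => h1 e)
  exact (h2.const_add (State.full (x 0) c)).congr (fun s hs => hF.full_eq (ht.trans hs) c)
    (hF.full_eq ht c)

end FluidLimit

/-! ### The Lyapunov function -/

/-- The total amount of servers that can take a further customer of type `i`. -/
def State.room (x : P.State) (i : ι) : ℝ := ∑ c ∈ P.fits i, State.full x c

theorem State.continuous_room (i : ι) : Continuous fun x : P.State => State.room x i :=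
  continuous_finsetSum _ fun c _ => State.continuous_full c

theorem State.room_pos {x : P.State} (hx : ∀ c, 0 < State.full x c) (i : ι) :
    0 < State.room x i := by
  classical
  obtain ⟨s, hs⟩ := P.unit_mem i
  refine Finset.sum_pos (fun c _ => hx c) ⟨P.emptyConf s, ?_⟩
  simp only [fits, Finset.mem_filter, Finset.mem_univ, true_and]
  change (0 : ι → ℕ) + Pi.single i 1 ∈ P.conf s
  rw [zero_add]
  convert hs

theorem log_sub_log_mul_sub_pos {y z : ℝ} (hy : 0 < y) (hz : 0 < z) (h : y ≠ z) :
    0 < (Real.log y - Real.log z) * (y - z) := by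
  rcases h.lt_or_gt with h | h
  · exact mul_pos_of_neg_of_neg (sub_neg.2 (Real.log_lt_log hy h)) (sub_neg.2 h)
  · exact mul_pos (sub_pos.2 (Real.log_lt_log hz h)) (sub_pos.2 h)

theorem log_sub_log_mul_sub_nonneg {y z : ℝ} (hy : 0 < y) (hz : 0 < z) :
    0 ≤ (Real.log y - Real.log z) * (y - z) := by
  rcases eq_or_ne y z with rfl | h
  · simp
  · exact (log_sub_log_mul_sub_pos hy hz h).le

theorem multiplierMap_upper (q : (σ → ℝ) × (ι → ℝ)) (e : P.Edge) :
    P.multiplierMap q e.upper = P.multiplierMap q e.lower + q.2 e.type := by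
  classical
  change q.1 e.upper.server + ∑ i, q.2 i * (e.upper.num i : ℝ)
    = q.1 e.lower.server + ∑ i, q.2 i * (e.lower.num i : ℝ) + q.2 e.type
  have : ∀ i, q.2 i * (e.upper.num i : ℝ)
      = q.2 i * (e.lower.num i : ℝ) + if i = e.type then q.2 i else 0 := fun i => by
    split_ifs with h
    · subst h
      rw [e.num_upper_type]
      push_cast
      ring
    · rw [e.num_upper_of_ne h, add_zero]
  simp_rw [this]
  rw [Finset.sum_add_distrib, Finset.sum_ite_eq' Finset.univ, if_pos (Finset.mem_univ _),
    e.server_lower]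
  ring

/-- A function of the configurations whose increment along each edge depends on the customer type
only is a combination of the constraints. -/
theorem eq_multiplierMap {Φ : P.Conf → ℝ} {ν : ι → ℝ}
    (h : ∀ e : P.Edge, Φ e.upper = Φ e.lower + ν e.type) (c : P.Conf) :
    Φ c = P.multiplierMap (fun s => Φ (P.emptyConf s), ν) c := by
  classical
  obtain ⟨n, hn⟩ : ∃ n, n = ∑ i, c.num i := ⟨_, rfl⟩
  induction n using Nat.strong_induction_on generalizing c with
  | _ n ih =>
    by_cases hc : c.num = 0
    · obtain ⟨s, k, hk⟩ := c
      obtain rfl : k = 0 := hc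
      change Φ (P.emptyConf s) = Φ (P.emptyConf s) + ∑ i, ν i * ((0 : ℕ) : ℝ)
      simp
    · obtain ⟨i, hi⟩ : ∃ i, 0 < c.num i := by
        by_contra! hall
        exact hc (funext fun i => Nat.le_zero.1 (hall i))
      let e : P.Edge := ⟨(c, i), hi⟩
      change Φ e.upper = P.multiplierMap _ e.upper
      rw [h e, multiplierMap_upper]
      congr 1
      refine ih (∑ i, e.lower.num i) ?_ e.lower rfl
      rw [hn]
      change _ < ∑ i, e.upper.num i
      refine Finset.sum_lt_sum (fun j _ => ?_) ⟨i, Finset.mem_univ _, ?_⟩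
      · rw [e.num_upper]
        exact Nat.le_add_right _ _
      · exact (Nat.lt_succ_self _).trans_eq e.num_upper_type.symm

open scoped Classical in
theorem sum_flux_type {x : P.State} {i : ι} (hx : 0 < State.room x i) :
    ∑ e with Edge.type e = i, flux x e = -(P.mu i * (State.load x i - P.rho i)) := by
  have h1 : ∀ e ∈ Finset.univ.filter (fun e : P.Edge => e.type = i), flux x e
      = P.lam i * (State.full x e.lower / State.room x i)
        - (e.upper.num i : ℝ) * State.full x e.upper * P.mu i := fun e he => by
    rw [← (Finset.mem_filter.1 he).2, flux, State.room]
    ring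
  rw [Finset.sum_congr rfl h1, Finset.sum_sub_distrib, ← Finset.mul_sum, ← Finset.sum_div,
    ← Finset.sum_mul, sum_edge_lower, sum_edge_upper i (State.full x), ← rho_mul_mu]
  change P.rho i * P.mu i * (State.room x i / State.room x i) - State.load x i * P.mu i = _
  rw [div_self hx.ne']
  ring

/-- Detailed balance in a product form state that carries the offered load. -/
theorem detailed_balance {xs : P.State} {q : (σ → ℝ) × (ι → ℝ)}
    (hxs : ∀ c, State.full xs c = Real.exp (P.multiplierMap q c) / c.weight)
    (hload : ∀ i, State.load xs i = P.rho i) (e : P.Edge) :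
    (e.upper.num e.type : ℝ) * State.full xs e.upper * State.room xs e.type
      = P.rho e.type * State.full xs e.lower := by
  classical
  have key : ∀ e : P.Edge, (e.upper.num e.type : ℝ) * State.full xs e.upper
      = Real.exp (q.2 e.type) * State.full xs e.lower := fun e => by
    have h1 := e.lower.weight_pos
    have h2 : (e.upper.num e.type : ℝ) ≠ 0 := Nat.cast_ne_zero.2 e.2.ne'
    rw [hxs, hxs, multiplierMap_upper, Real.exp_add, e.weight_upper]
    field_simp
  have hrho : P.rho e.type = Real.exp (q.2 e.type) * State.room xs e.type := by
    rw [← hload, State.load, ← sum_edge_upper, State.room, ← sum_edge_lower, Finset.mul_sum]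
    refine Finset.sum_congr rfl fun e' he' => ?_
    have := key e'
    rwa [(Finset.mem_filter.1 he').2] at this
  rw [key, hrho]
  ring

/-- The amount of servers in configuration `c`, relative to that in the state `xs`. -/
def relAmount (xs x : P.State) (c : P.Conf) : ℝ := State.full x c / State.full xs c

/-- The amount of room for customers of type `i` in `xs`, relative to that in the state `x`. -/
def relRoom (xs x : P.State) (i : ι) : ℝ := State.room xs i / State.room x i

/-- The rate at which the relative entropy is dissipated: the symmetrized relative entropies of
the arrival and departure rates along the edges. -/
def dissipation (xs x : P.State) : ℝ :=
  ∑ e : P.Edge, (e.upper.num e.type : ℝ) * P.mu e.type * State.full xs e.upper *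
    ((Real.log (relRoom xs x e.type * relAmount xs x e.lower)
        - Real.log (relAmount xs x e.upper))
      * (relRoom xs x e.type * relAmount xs x e.lower - relAmount xs x e.upper))

theorem flux_eq {xs x : P.State} {q : (σ → ℝ) × (ι → ℝ)}
    (hxs : ∀ c, State.full xs c = Real.exp (P.multiplierMap q c) / c.weight)
    (hload : ∀ i, State.load xs i = P.rho i) (hpos : ∀ c, 0 < State.full xs c) (e : P.Edge) :
    flux x e = (e.upper.num e.type : ℝ) * P.mu e.type * State.full xs e.upper *
      (relRoom xs x e.type * relAmount xs x e.lower - relAmount xs x e.upper) := by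
  have h1 := detailed_balance hxs hload e
  have h2 := (hpos e.lower).ne'
  have h3 := (hpos e.upper).ne'
  have h4 : (e.upper.num e.type : ℝ) * P.mu e.type * State.full xs e.upper *
      (relRoom xs x e.type * relAmount xs x e.lower)
      = P.lam e.type * (State.full x e.lower / State.room x e.type) := by
    rw [relRoom, relAmount, ← rho_mul_mu]
    calc _ = (e.upper.num e.type * State.full xs e.upper * State.room xs e.type) * P.mu e.type
          * (State.full x e.lower / State.room x e.type) / State.full xs e.lower := by ring
      _ = _ := by
        rw [h1]
        field_simp
  rw [mul_sub, h4, flux, relAmount]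
  change _ * (_ / State.room x e.type) - _ = _
  field_simp

/-- The relative entropy changes at the rate of its dissipation, up to a term that is due to the
imbalance between the loads and the offered loads. -/
theorem sum_log_mul_netFlow_flux {xs x : P.State} {q : (σ → ℝ) × (ι → ℝ)}
    (hxs : ∀ c, State.full xs c = Real.exp (P.multiplierMap q c) / c.weight)
    (hload : ∀ i, State.load xs i = P.rho i) (hpos : ∀ c, 0 < State.full xs c)
    (hx : ∀ c, 0 < State.full x c) :
    ∑ c, Real.log (relAmount xs x c) * netFlow (flux x) c = -dissipation xs x
      - ∑ i, Real.log (relRoom xs x i) * (P.mu i * (State.load x i - P.rho i)) := by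
  classical
  have hA : ∀ c, 0 < relAmount xs x c := fun c => div_pos (hx c) (hpos c)
  have hR : ∀ i, 0 < relRoom xs x i := fun i =>
    div_pos (State.room_pos hpos i) (State.room_pos hx i)
  have h1 : ∑ i, Real.log (relRoom xs x i) * (P.mu i * (State.load x i - P.rho i))
      = -∑ e : P.Edge, Real.log (relRoom xs x e.type) * flux x e := by
    rw [← Finset.sum_fiberwise Finset.univ Edge.type, ← Finset.sum_neg_distrib]
    refine Finset.sum_congr rfl fun i _ => ?_
    rw [eq_neg_iff_add_eq_zero, ← neg_eq_iff_add_eq_zero, ← mul_neg,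
      ← sum_flux_type (State.room_pos hx i), Finset.mul_sum]
    refine Finset.sum_congr rfl fun e he => ?_
    rw [(Finset.mem_filter.1 he).2]
  rw [sum_mul_netFlow (fun c => Real.log (relAmount xs x c)), h1, dissipation, sub_neg_eq_add,
    ← Finset.sum_neg_distrib, ← Finset.sum_add_distrib]
  refine Finset.sum_congr rfl fun e _ => ?_
  rw [flux_eq hxs hload hpos, Real.log_mul (hR _).ne' (hA _).ne']
  ring

theorem dissipation_nonneg {xs x : P.State} (hpos : ∀ c, 0 < State.full xs c)
    (hx : ∀ c, 0 < State.full x c) : 0 ≤ dissipation xs x :=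
  Finset.sum_nonneg fun _ _ => mul_nonneg
    (mul_nonneg (mul_nonneg (Nat.cast_nonneg _) (P.mu_pos _).le) (hpos _).le)
    (log_sub_log_mul_sub_nonneg
      (mul_pos (div_pos (State.room_pos hpos _) (State.room_pos hx _)) (div_pos (hx _) (hpos _)))
      (div_pos (hx _) (hpos _)))

/-- If nothing is dissipated then the relative amounts are in product form, and two states with
the same loads whose ratio is in product form agree. -/
theorem eq_of_dissipation_eq_zero {xs x : P.State} (hpos : ∀ c, 0 < State.full xs c)
    (hx : ∀ c, 0 < State.full x c) (hload : ∀ i, State.load x i = State.load xs i)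
    (h : dissipation xs x = 0) : x = xs := by
  classical
  have hA : ∀ c, 0 < relAmount xs x c := fun c => div_pos (hx c) (hpos c)
  have hR : ∀ i, 0 < relRoom xs x i := fun i =>
    div_pos (State.room_pos hpos i) (State.room_pos hx i)
  have hw : ∀ e : P.Edge,
      0 < (e.upper.num e.type : ℝ) * P.mu e.type * State.full xs e.upper := fun e =>
    mul_pos (mul_pos (Nat.cast_pos.2 e.2) (P.mu_pos _)) (hpos _)
  have hedge : ∀ e : P.Edge, Real.log (relAmount xs x e.upper)
      = Real.log (relAmount xs x e.lower) + Real.log (relRoom xs x e.type) := fun e => by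
    have h0 := (Finset.sum_eq_zero_iff_of_nonneg fun _ _ => mul_nonneg (hw _).le
      (log_sub_log_mul_sub_nonneg (mul_pos (hR _) (hA _)) (hA _))).1 h e
      (Finset.mem_univ e)
    have h1 := (mul_eq_zero.1 h0).resolve_left (hw e).ne'
    have h2 : relRoom xs x e.type * relAmount xs x e.lower = relAmount xs x e.upper := by
      by_contra hne
      exact (log_sub_log_mul_sub_pos (mul_pos (hR _) (hA _)) (hA _) hne).ne' h1
    rw [← h2, Real.log_mul (hR _).ne' (hA _).ne', add_comm]
  obtain ⟨q, hprod⟩ : ∃ q, ∀ c, Real.log (relAmount xs x c) = P.multiplierMap q c :=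
    ⟨_, eq_multiplierMap (Φ := fun c => Real.log (relAmount xs x c))
      (ν := fun i => Real.log (relRoom xs x i)) hedge⟩
  have hsum : ∑ c, (State.full x c - State.full xs c) * Real.log (relAmount xs x c) = 0 := by
    simp_rw [hprod]
    rw [sum_mul_multiplierMap]
    simp_rw [mul_sub, Finset.sum_sub_distrib, State.sum_full_server]
    have : ∀ i, ∑ c : P.Conf, (c.num i : ℝ) * State.full x c
        = ∑ c : P.Conf, (c.num i : ℝ) * State.full xs c := hload
    simp_rw [this]
    simp
  have hlog : ∀ c, Real.log (relAmount xs x c)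
      = Real.log (State.full x c) - Real.log (State.full xs c) := fun c =>
    Real.log_div (hx c).ne' (hpos c).ne'
  have hsum' : ∑ c, (Real.log (State.full x c) - Real.log (State.full xs c))
      * (State.full x c - State.full xs c) = 0 := by
    rw [← hsum]
    exact Finset.sum_congr rfl fun c _ => by rw [hlog, mul_comm]
  refine State.full_injective (funext fun c => ?_)
  by_contra hne
  exact (log_sub_log_mul_sub_pos (hx c) (hpos c) hne).ne'
    ((Finset.sum_eq_zero_iff_of_nonneg fun c _ => log_sub_log_mul_sub_nonneg (hx c) (hpos c)).1
      hsum' c (Finset.mem_univ c))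

theorem continuousOn_dissipation {xs : P.State} (hpos : ∀ c, 0 < State.full xs c)
    {s : Set P.State} (hs : ∀ x ∈ s, ∀ c, 0 < State.full x c) :
    ContinuousOn (dissipation xs) s := by
  have hA : ∀ c, ContinuousOn (fun x => relAmount xs x c) s := fun c =>
    ((State.continuous_full c).div_const _).continuousOn
  have hR : ∀ i, ContinuousOn (fun x => relRoom xs x i) s := fun i =>
    continuousOn_const.div (State.continuous_room i).continuousOn
      fun x hx => (State.room_pos (hs x hx) i).ne'
  have hA0 : ∀ c, ∀ x ∈ s, relAmount xs x c ≠ 0 := fun c x hx =>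
    (div_pos (hs x hx c) (hpos c)).ne'
  have hR0 : ∀ i, ∀ x ∈ s, relRoom xs x i ≠ 0 := fun i x hx =>
    (div_pos (State.room_pos hpos i) (State.room_pos (hs x hx) i)).ne'
  refine continuousOn_finsetSum _ fun e _ => continuousOn_const.mul ?_
  exact ((((hR _).mul (hA _)).log fun x hx => mul_ne_zero (hR0 _ x hx) (hA0 _ x hx)).sub
    ((hA _).log (hA0 _))).mul (((hR _).mul (hA _)).sub (hA _))

theorem hasDerivWithinAt_abs_of_linear {f : ℝ → ℝ} {k t : ℝ} {s : Set ℝ}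
    (h : HasDerivWithinAt f (-(k * f t)) s t) :
    HasDerivWithinAt (fun u => |f u|) (-(k * |f t|)) s t := by
  rcases lt_trichotomy (f t) 0 with h0 | h0 | h0
  · refine ((hasDerivAt_abs_neg h0).comp_hasDerivWithinAt t h).congr_deriv ?_
    rw [abs_of_neg h0]
    ring
  · have h1 : -(k * f t) = 0 := by rw [h0, mul_zero, neg_zero]
    rw [h1, hasDerivWithinAt_iff_isLittleO] at h
    rw [h0, abs_zero, mul_zero, neg_zero, hasDerivWithinAt_iff_isLittleO]
    simp only [h0, abs_zero, sub_zero, smul_zero] at h ⊢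
    exact h.norm_left
  · refine ((hasDerivAt_abs_pos h0).comp_hasDerivWithinAt t h).congr_deriv ?_
    rw [abs_of_pos h0]
    ring

/-- The Lyapunov function: the relative entropy, plus a multiple of the deviations of the loads from
the offered loads. These decay by themselves and pay for the error term in
`sum_log_mul_netFlow_flux`. -/
def lyapunov (xs x : P.State) : ℝ :=
  relEntropy xs x + ∑ i, 2 * |State.load x i - P.rho i|

/-- A lower bound for the rate of decrease of `lyapunov` near `xs`. -/
def lyapunovRate (xs x : P.State) : ℝ :=
  dissipation xs x + ∑ i, P.mu i * |State.load x i - P.rho i|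

section FluidLimit

variable {x : ℝ → P.State} {d a : ℝ → P.Edge → ℝ} {ω : P.Driving}
  {index : ι → P.Conf → ℕ} {r : ℕ → ℝ} {H : ℕ → σ → ℕ} {X : ℕ → ℝ → P.Conf → ℕ}
  {D A : ℕ → ℝ → P.Edge → ℕ}

theorem IsFluidLimit.hasDerivWithinAt_load (hF : IsFluidLimit x d a ω index r H X D A) {t : ℝ}
    (ht : 0 ≤ t) (hx : ∀ c, 0 < State.full (x t) c) (i : ι) :
    HasDerivWithinAt (fun s => State.load (x s) i)
      (-(P.mu i * (State.load (x t) i - P.rho i))) (Set.Ici t) t := by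
  classical
  rw [← sum_flux_type (State.room_pos hx i), ← sum_num_mul_netFlow]
  exact HasDerivWithinAt.fun_sum fun c _ =>
    (hF.hasDerivWithinAt_full ht (State.room_pos hx) c).const_mul _

theorem IsFluidLimit.hasDerivWithinAt_relEntropy (hF : IsFluidLimit x d a ω index r H X D A)
    {xs : P.State} (hpos : ∀ c, 0 < State.full xs c) {t : ℝ} (ht : 0 ≤ t)
    (hx : ∀ c, 0 < State.full (x t) c) :
    HasDerivWithinAt (fun s => relEntropy xs (x s))
      (∑ c, Real.log (relAmount xs (x t) c) * netFlow (flux (x t)) c) (Set.Ici t) t := by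
  refine HasDerivWithinAt.fun_sum fun c _ => ?_
  have h1 := (hF.hasDerivWithinAt_full ht (State.room_pos hx) c).div_const (State.full xs c)
  have h2 := (InformationTheory.hasDerivAt_klFun
    (div_pos (hx c) (hpos c)).ne').comp_hasDerivWithinAt t h1
  refine (h2.const_mul (State.full xs c)).congr_deriv ?_
  unfold relAmount
  have := (hpos c).ne'
  field_simp

theorem IsFluidLimit.exists_hasDerivWithinAt_lyapunov
    (hF : IsFluidLimit x d a ω index r H X D A) {xs : P.State} {q : (σ → ℝ) × (ι → ℝ)}
    (hxs : ∀ c, State.full xs c = Real.exp (P.multiplierMap q c) / c.weight)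
    (hload : ∀ i, State.load xs i = P.rho i) (hpos : ∀ c, 0 < State.full xs c) {t : ℝ}
    (ht : 0 ≤ t) (hx : ∀ c, 0 < State.full (x t) c)
    (hroom : ∀ i, |Real.log (relRoom xs (x t) i)| ≤ 1) :
    ∃ w', w' ≤ -lyapunovRate xs (x t) ∧
      HasDerivWithinAt (fun s => lyapunov xs (x s)) w' (Set.Ici t) t := by
  have h1 := hF.hasDerivWithinAt_relEntropy hpos ht hx
  rw [sum_log_mul_netFlow_flux hxs hload hpos hx] at h1
  refine ⟨_, ?_, h1.add (HasDerivWithinAt.fun_sum fun i _ =>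
    (hasDerivWithinAt_abs_of_linear
      ((hF.hasDerivWithinAt_load ht hx i).sub_const (P.rho i))).const_mul 2)⟩
  rw [lyapunovRate, neg_add, sub_eq_add_neg, add_assoc, ← Finset.sum_neg_distrib,
    ← Finset.sum_neg_distrib, ← Finset.sum_add_distrib]
  refine add_le_add le_rfl (Finset.sum_le_sum fun i _ => ?_)
  have h2 : -(Real.log (relRoom xs (x t) i) * (P.mu i * (State.load (x t) i - P.rho i)))
      ≤ P.mu i * |State.load (x t) i - P.rho i| := by
    refine (neg_le_abs _).trans ?_
    rw [abs_mul, abs_mul, abs_of_pos (P.mu_pos i)]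
    exact mul_le_of_le_one_left (mul_nonneg (P.mu_pos i).le (abs_nonneg _)) (hroom i)
  linarith

end FluidLimit

/-- Near a positive state all servers remain in use and the relative room is close to `1`. -/
theorem exists_closedBall {xs : P.State} (hpos : ∀ c, 0 < State.full xs c) :
    ∃ R : ℝ, 0 < R ∧ ∀ x ∈ Metric.closedBall xs R,
      (∀ c, 0 < State.full x c) ∧ ∀ i, |Real.log (relRoom xs x i)| ≤ 1 := by
  have h1 : ∀ᶠ x in 𝓝 xs, ∀ c, 0 < State.full x c := eventually_all.2 fun c =>
    ((State.continuous_full c).tendsto xs).eventually_const_lt (hpos c)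
  have h2 : ∀ᶠ x in 𝓝 xs, ∀ i, |Real.log (relRoom xs x i)| ≤ 1 := eventually_all.2 fun i => by
    have hr := State.room_pos hpos i
    have hone : relRoom xs xs i = 1 := div_self hr.ne'
    have hc : Tendsto (fun x => |Real.log (relRoom xs x i)|) (𝓝 xs)
        (𝓝 |Real.log (relRoom xs xs i)|) :=
      ((tendsto_const_nhds.div ((State.continuous_room i).tendsto xs) hr.ne').log
        (hone.trans_ne one_ne_zero)).abs
    rw [hone, Real.log_one, abs_zero] at hc
    exact hc.eventually_le_const one_pos
  obtain ⟨R, hR, hsub⟩ := Metric.nhds_basis_closedBall.mem_iff.1 (h1.and h2)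
  exact ⟨R, hR, fun x hx => hsub hx⟩

end PackingModel

end

open PackingModel in
theorem mainTheorem4 {ι σ : Type*} [Fintype ι] [Fintype σ] (P : PackingModel ι σ)
    (hP : P.Feasible) :
    ∃ xs : P.State, (P.IsOptimal xs ∧ ∀ y, P.IsOptimal y → y = xs) ∧
      ∃ ε : ℝ, 0 < ε ∧ ∀ η : ℝ, 0 < η → ∃ T : ℝ, 0 ≤ T ∧
        ∀ (Q : P.SystemSequence) (x : ℝ → P.State) (d a : ℝ → P.Edge → ℝ),
          P.IsFluidSamplePath Q x d a → x 0 ∈ P.box → ‖x 0 - xs‖ ≤ ε →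
            ∀ t : ℝ, T ≤ t → ‖x t - xs‖ < η := by
  obtain ⟨xs, q, hxs, hload⟩ := hP.exists_productForm
  have hpos : ∀ c, 0 < State.full xs c := fun c => by
    rw [hxs c]
    exact div_pos (Real.exp_pos _) c.weight_pos
  refine ⟨xs, isOptimal_unique_of_productForm hxs hload, ?_⟩
  obtain ⟨R, hR, hball⟩ := exists_closedBall hpos
  have hsum : ∀ k : ι → ℝ, (∀ i, 0 ≤ k i) → ∀ x : P.State,
      0 ≤ ∑ i, k i * |State.load x i - P.rho i| := fun k hk x =>
    Finset.sum_nonneg fun i _ => mul_nonneg (hk i) (abs_nonneg _)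
  have hsumc : ∀ k : ι → ℝ, Continuous fun x : P.State =>
      ∑ i, k i * |State.load x i - P.rho i| := fun k =>
    continuous_finsetSum _ fun i _ =>
      continuous_const.mul ((State.continuous_load i).sub continuous_const).abs
  have hrate : ∀ x ∈ P.box ∩ Metric.closedBall xs R, 0 ≤ lyapunovRate xs x := fun x hx =>
    add_nonneg (dissipation_nonneg hpos (hball x hx.2).1) (hsum _ (fun i => (P.mu_pos i).le) x)
  have hxsK : xs ∈ P.box ∩ Metric.closedBall xs R :=
    ⟨mem_box_iff.2 fun c => (hpos c).le, Metric.mem_closedBall_self hR.le⟩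
  obtain ⟨ε, hε, hmain⟩ := exists_uniform_attraction isClosed_box hxsK.1 hR
    (W := lyapunov xs) (g := lyapunovRate xs)
    ((continuous_relEntropy xs).add (hsumc _)).continuousOn
    ((continuousOn_dissipation hpos fun x hx => (hball x hx.2).1).add (hsumc _).continuousOn)
    (by simp [lyapunov, relEntropy_self hpos, hload])
    (hrate xs hxsK)
    (fun x hx hne => add_pos_of_pos_of_nonneg (relEntropy_pos hpos hx.1 hne)
      (hsum _ (fun _ => zero_le_two) x))
    (fun x hx hne => by
      refine lt_of_le_of_ne (hrate x hx) fun h0 => hne ?_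
      have h1 := dissipation_nonneg hpos (hball x hx.2).1
      have h2 := hsum _ (fun i => (P.mu_pos i).le) x
      have h3 : 0 = dissipation xs x + ∑ i, P.mu i * |State.load x i - P.rho i| := h0
      have h4 : ∑ i, P.mu i * |State.load x i - P.rho i| = 0 := by linarith
      refine eq_of_dissipation_eq_zero hpos (hball x hx.2).1 (fun i => ?_) (by linarith)
      have h5 := (Finset.sum_eq_zero_iff_of_nonneg fun i _ =>
        mul_nonneg (P.mu_pos i).le (abs_nonneg _)).1 h4 i (Finset.mem_univ i)
      rw [hload]
      exact sub_eq_zero.1 (abs_eq_zero.1 ((mul_eq_zero.1 h5).resolve_left (P.mu_pos i).ne')))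
  refine ⟨ε, hε, fun η hη => ?_⟩
  obtain ⟨T, hT, hu⟩ := hmain η hη
  refine ⟨T, hT, fun Q x d a hfsp _ hx0 => ?_⟩
  obtain ⟨ω, index, r, H, X, D, A, hF⟩ := hfsp.exists_isFluidLimit
  exact hu x hF.continuousOn (fun t ht => hF.mem_box ht) (fun t ht hmem =>
    hF.exists_hasDerivWithinAt_lyapunov hxs hload hpos ht (hball _ hmem).1 (hball _ hmem).2) hx0
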